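/- Let $(M,w)$ be a (smooth, finite-dimensional, Hausdorff) Poisson manifold with bracket $\{f,g\}=w(df,dg)$, let $\sharp:T^*M\to TM$ be given by $\beta(\sharp\alpha)=w(\alpha,\beta)$, and let $X_f=\sharp\,df$ be the Hamiltonian vector field of $f\in C^\infty(M)$. Let $\nabla$ be a smooth linear connection on $M$, with $\nabla_{\partial_i}\partial_j=\Gamma^k_{ij}\partial_k$ in local coordinates $(x^i)$ and curvature $R_\nabla(X,Y)Z=\nabla_X\nabla_YZ-\nabla_Y\nabla_XZ-\nabla_{[X,Y]}Z$. On $T^*M$, with the induced coordinates $(x^i,p_i)$, consider the nonlinear connection defined by $\nabla$, i.e. the horizontal distribution spanned by $$\frac{\delta}{\delta x^i}=\frac{\partial}{\partial x^i}-N_{ij}\frac{\partial}{\partial p_j},\qquad N_{ij}=-p_k\Gamma^k_{ij},$$ and the horizontal lift of $w=\frac12 w^{ij}\,\frac{\partial}{\partial x^i}\wedge\frac{\partial}{\partial x^j}$, i.e. the bivector field $$w^H=\frac12\,w^{ij}(x)\,\frac{\delta}{\delta x^i}\wedge\frac{\delta}{\delta x^j}$$ on $T^*M$. Let $D_\alpha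 Z=\nabla_{\sharp\alpha}Z$ ($\alpha$ a $1$-form, $Z$ a vector field on $M$) be the contravariant connection on $TM$ induced by $\nabla$, with curvature $C_D(\alpha,\beta)Z=D_\alpha D_\beta Z-D_\beta D_\alpha Z-D_{[\alpha,\beta]_w}Z$, where $[\alpha,\beta]_w=L_{\sharp\alpha}\beta-L_{\sharp\beta}\alpha-d(w(\alpha,\beta))$. Then $w^H$ is a Poisson structure on $T^*M$ if and only if $C_D=0$, i.e. $C_D(\alpha,\beta)Z=0$ for all smooth $1$-forms $\alpha,\beta$ and all smooth vector fields $Z$ on $M$. Equivalently, $w^H$ is a Poisson structure on $T^*M$ if and only if $R_\nabla(X_f,X_g)Z=0$ for all $f,g\in C^\infty(M)$ and all smooth vector fields $Z$ on $M$. -/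

import Mathlib

open Bundle Manifold ContDiff

noncomputable section

/-! ### Bivector fields and Poisson structures on an arbitrary manifold -/

section Poisson

variable {E : Type*} [NormedAddCommGroup E] [NormedSpace ℝ E]
  {H : Type*} [TopologicalSpace H] (I : ModelWithCorners ℝ E H)
  (N : Type*) [TopologicalSpace N] [ChartedSpace H N]

/-- A field of bilinear forms on the cotangent spaces of `N`, i.e. a (not necessarily smooth or
skew-symmetric) 2-contravariant tensor field. -/
abbrev ContravariantTwoTensor : Type _ :=
  ∀ x : N, (TangentSpace I x →L[ℝ] ℝ) →ₗ[ℝ] (TangentSpace I x →L[ℝ] ℝ) →ₗ[ℝ] ℝ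

variable {I N}

namespace ContravariantTwoTensor

/-- The bracket `{f, g} = W(df, dg)` of functions defined by `W`. -/
def bracket (W : ContravariantTwoTensor I N) (f g : N → ℝ) : N → ℝ :=
  fun x => W x (mvfderiv I f x) (mvfderiv I g x)

/-- `W` is a smooth bivector field: it is skew-symmetric, and `W(df, dg)` is smooth for all
smooth functions `f`, `g` on `N`. -/
structure IsBivectorField (W : ContravariantTwoTensor I N) : Prop where
  alternating : ∀ (x : N) (α : TangentSpace I x →L[ℝ] ℝ), W x α α = 0
  smooth : ∀ f g : N → ℝ, ContMDiff I 𝓘(ℝ, ℝ) ∞ f → ContMDiff I 𝓘(ℝ, ℝ) ∞ g →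
    ContMDiff I 𝓘(ℝ, ℝ) ∞ (W.bracket f g)

/-- `W` is a Poisson structure: it is a smooth bivector field whose bracket on smooth functions
satisfies the Jacobi identity. -/
structure IsPoisson (W : ContravariantTwoTensor I N) : Prop extends IsBivectorField W where
  jacobi : ∀ f g h : N → ℝ, ContMDiff I 𝓘(ℝ, ℝ) ∞ f → ContMDiff I 𝓘(ℝ, ℝ) ∞ g →
    ContMDiff I 𝓘(ℝ, ℝ) ∞ h →
    W.bracket (W.bracket f g) h + W.bracket (W.bracket g h) f + W.bracket (W.bracket h f) g = 0

end ContravariantTwoTensor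

end Poisson

/-! ### The base manifold `M`: sharp map, bracket of 1-forms, curvatures -/

section Base

variable {E : Type*} [NormedAddCommGroup E] [NormedSpace ℝ E] [FiniteDimensional ℝ E]
  {M : Type*} [TopologicalSpace M] [ChartedSpace E M]

instance tangentSpaceFiniteDimensional (x : M) :
    FiniteDimensional ℝ (TangentSpace 𝓘(ℝ, E) x) :=
  inferInstanceAs (FiniteDimensional ℝ E)

instance tangentSpaceT2Space (x : M) : T2Space (TangentSpace 𝓘(ℝ, E) x) :=
  inferInstanceAs (T2Space E)

/-- The cotangent space `T*_x M`. -/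
abbrev CotangentSpace (E : Type*) [NormedAddCommGroup E] [NormedSpace ℝ E]
    {M : Type*} [TopologicalSpace M] [ChartedSpace E M] (x : M) : Type _ :=
  TangentSpace 𝓘(ℝ, E) x →L[ℝ] Bundle.Trivial M ℝ x

/-- The sharp map `♯ : T*_x M → T_x M` of `w`. It is characterized by `β (♯ α) = w(α, β)`,
see `ContravariantTwoTensor.apply_sharp`; the formula below is `♯ α = ∑ i, w(α, eⁱ) eᵢ`
for a basis `(eᵢ)` of `T_x M` with dual basis `(eⁱ)`. -/
def ContravariantTwoTensor.sharp (w : ContravariantTwoTensor 𝓘(ℝ, E) M) (x : M)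
    (α : CotangentSpace E x) : TangentSpace 𝓘(ℝ, E) x :=
  let b := Module.finBasis ℝ (TangentSpace 𝓘(ℝ, E) x)
  ∑ i, w x α (LinearMap.toContinuousLinearMap (b.coord i)) • b i

theorem ContravariantTwoTensor.apply_sharp (w : ContravariantTwoTensor 𝓘(ℝ, E) M) (x : M)
    (α β : CotangentSpace E x) : β (w.sharp x α) = w x α β := by
  set b := Module.finBasis ℝ (TangentSpace 𝓘(ℝ, E) x) with hb
  have hβ : β = ∑ i, β (b i) • LinearMap.toContinuousLinearMap (b.coord i) := by
    refine ContinuousLinearMap.coe_injective (b.ext fun j => ?_)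
    simp [Finsupp.single_apply]
  conv_rhs => rw [hβ]
  simp only [sharp, map_sum, map_smul, smul_eq_mul]
  exact Finset.sum_congr rfl fun i _ => mul_comm _ _

/-- The Hamiltonian vector field `X_f = ♯ df` of the function `f`. -/
def ContravariantTwoTensor.hamiltonian (w : ContravariantTwoTensor 𝓘(ℝ, E) M) (f : M → ℝ) :
    ∀ x : M, TangentSpace 𝓘(ℝ, E) x :=
  fun x => w.sharp x (mvfderiv 𝓘(ℝ, E) f x)

variable [IsManifold 𝓘(ℝ, E) ∞ M]

/-- Smoothness of a vector field on `M`. -/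
def IsSmoothVectorField (Z : ∀ x : M, TangentSpace 𝓘(ℝ, E) x) : Prop :=
  ContMDiff 𝓘(ℝ, E) (𝓘(ℝ, E).prod 𝓘(ℝ, E)) ∞
    (fun x => TotalSpace.mk' E x (Z x) : M → TangentBundle 𝓘(ℝ, E) M)

/-- Smoothness of a 1-form on `M`. -/
def IsSmoothOneForm (α : ∀ x : M, CotangentSpace E x) : Prop :=
  ContMDiff 𝓘(ℝ, E) (𝓘(ℝ, E).prod 𝓘(ℝ, E →L[ℝ] ℝ)) ∞
    (fun x => TotalSpace.mk' (E →L[ℝ] ℝ) x (α x) :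
      M → TotalSpace (E →L[ℝ] ℝ) (CotangentSpace E : M → Type _))

/-- The value at `x` of the Lie derivative `(L_X β)(Z) = X(β(Z)) - β([X, Z])`. -/
def lieDerivOneForm (X : ∀ x : M, TangentSpace 𝓘(ℝ, E) x) (β : ∀ x : M, CotangentSpace E x)
    (x : M) (Z : ∀ x : M, TangentSpace 𝓘(ℝ, E) x) : ℝ :=
  mvfderiv 𝓘(ℝ, E) (fun y => (β y (Z y) : ℝ)) x (X x)
    - β x (VectorField.mlieBracket 𝓘(ℝ, E) X Z x)

/-- The value at `x` of `(L_{♯α} β - L_{♯β} α - d(w(α, β)))(Z)`. -/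
def oneFormBracketAux (w : ContravariantTwoTensor 𝓘(ℝ, E) M)
    (α β : ∀ x : M, CotangentSpace E x) (x : M) (Z : ∀ x : M, TangentSpace 𝓘(ℝ, E) x) : ℝ :=
  lieDerivOneForm (fun y => w.sharp y (α y)) β x Z
    - lieDerivOneForm (fun y => w.sharp y (β y)) α x Z
    - mvfderiv 𝓘(ℝ, E) (fun y => w y (α y) (β y)) x (Z x)

theorem lieDerivOneForm_tensorialAt (X : ∀ x : M, TangentSpace 𝓘(ℝ, E) x)
    {β : ∀ x : M, CotangentSpace E x} (hβ : IsSmoothOneForm β) (x : M) :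
    TensorialAt 𝓘(ℝ, E) E (lieDerivOneForm X β x) x := by
  have : CompleteSpace E := FiniteDimensional.complete ℝ E
  have hβ' := (hβ x).mdifferentiableAt (by simp)
  have key : ∀ {σ : ∀ x : M, TangentSpace 𝓘(ℝ, E) x}, MDiffAt (T% σ) x →
      MDifferentiableAt 𝓘(ℝ, E) 𝓘(ℝ, ℝ) (fun y => (β y (σ y) : ℝ)) x := by
    intro σ hσ
    have h := (mdifferentiableAt_totalSpace _ _).1 (hβ'.clm_bundle_apply hσ)
    simpa using h.2
  constructor
  · intro f σ hf hσ
    have h1 : (fun y => (β y ((f • σ) y) : ℝ)) = f * fun y => (β y (σ y) : ℝ) := by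
      ext y; simp
    simp only [lieDerivOneForm]
    rw [h1, mvfderiv_mul hf (key hσ), VectorField.mlieBracket_smul_right hf hσ]
    simp only [map_add, map_smul, add_apply, smul_apply,
      smul_eq_mul]
    ring
  · intro σ σ' hσ hσ'
    have h1 : (fun y => (β y ((σ + σ') y) : ℝ)) =
        (fun y => (β y (σ y) : ℝ)) + fun y => (β y (σ' y) : ℝ) := by
      ext y; simp
    simp only [lieDerivOneForm]
    rw [h1, mvfderiv_add (key hσ) (key hσ'), VectorField.mlieBracket_add_right hσ hσ']
    simp only [map_add, add_apply]
    ring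

/-- The bracket of 1-forms on `(M, w)`: for smooth `α`, `β` it is the 1-form
`L_{♯α} β - L_{♯β} α - d(w(α, β))`, see `oneFormBracket_apply`. -/
def oneFormBracket (w : ContravariantTwoTensor 𝓘(ℝ, E) M)
    (α β : ∀ x : M, CotangentSpace E x) (x : M) : CotangentSpace E x :=
  open Classical in
  if h : TensorialAt 𝓘(ℝ, E) E (oneFormBracketAux w α β x) x then
    TensorialAt.mkHom (oneFormBracketAux w α β x) x h
  else 0

theorem oneFormBracketAux_tensorialAt (w : ContravariantTwoTensor 𝓘(ℝ, E) M)
    {α β : ∀ x : M, CotangentSpace E x} (hα : IsSmoothOneForm α) (hβ : IsSmoothOneForm β) (x : M) :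
    TensorialAt 𝓘(ℝ, E) E (oneFormBracketAux w α β x) x := by
  have h1 := lieDerivOneForm_tensorialAt (fun y => w.sharp y (α y)) hβ x
  have h2 := lieDerivOneForm_tensorialAt (fun y => w.sharp y (β y)) hα x
  constructor
  · intro f σ hf hσ
    simp only [oneFormBracketAux, h1.smul hf hσ, h2.smul hf hσ, Pi.smul_apply', map_smul]
    simp only [smul_eq_mul]; ring
  · intro σ σ' hσ hσ'
    simp only [oneFormBracketAux, h1.add hσ hσ', h2.add hσ hσ', Pi.add_apply, map_add]
    ring

theorem oneFormBracket_apply (w : ContravariantTwoTensor 𝓘(ℝ, E) M)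
    {α β : ∀ x : M, CotangentSpace E x} (hα : IsSmoothOneForm α) (hβ : IsSmoothOneForm β)
    {Z : ∀ x : M, TangentSpace 𝓘(ℝ, E) x} (hZ : IsSmoothVectorField Z) (x : M) :
    oneFormBracket w α β x (Z x) =
      lieDerivOneForm (fun y => w.sharp y (α y)) β x Z
        - lieDerivOneForm (fun y => w.sharp y (β y)) α x Z
        - mvfderiv 𝓘(ℝ, E) (fun y => w y (α y) (β y)) x (Z x) := by
  have h := oneFormBracketAux_tensorialAt w hα hβ x
  rw [oneFormBracket, dif_pos h]
  exact h.mkHom_apply ((hZ x).mdifferentiableAt (by simp))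

/-- A linear connection on `M`, in the order of arguments of Mathlib:
`nabla Z x v` is `∇_v Z` at `x`. -/
abbrev LinearConnection (E : Type*) [NormedAddCommGroup E] [NormedSpace ℝ E]
    (M : Type*) [TopologicalSpace M] [ChartedSpace E M] [IsManifold 𝓘(ℝ, E) ∞ M] : Type _ :=
  CovariantDerivative 𝓘(ℝ, E) E (TangentSpace 𝓘(ℝ, E) : M → Type _)

/-- The vector field `∇_X Z`. -/
def LinearConnection.deriv (nabla : LinearConnection E M) (X Z : ∀ x : M, TangentSpace 𝓘(ℝ, E) x) :
    ∀ x : M, TangentSpace 𝓘(ℝ, E) x :=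
  fun x => nabla Z x (X x)

/-- The curvature `R_∇(X, Y)Z = ∇_X ∇_Y Z - ∇_Y ∇_X Z - ∇_[X, Y] Z`. -/
def LinearConnection.curvature (nabla : LinearConnection E M)
    (X Y Z : ∀ x : M, TangentSpace 𝓘(ℝ, E) x) : ∀ x : M, TangentSpace 𝓘(ℝ, E) x :=
  nabla.deriv X (nabla.deriv Y Z) - nabla.deriv Y (nabla.deriv X Z)
    - nabla.deriv (VectorField.mlieBracket 𝓘(ℝ, E) X Y) Z

/-- The contravariant connection `D_α Z = ∇_{♯α} Z` on `TM` induced by `∇` on `(M, w)`. -/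
def LinearConnection.contravariant (nabla : LinearConnection E M)
    (w : ContravariantTwoTensor 𝓘(ℝ, E) M)
    (α : ∀ x : M, CotangentSpace E x) (Z : ∀ x : M, TangentSpace 𝓘(ℝ, E) x) :
    ∀ x : M, TangentSpace 𝓘(ℝ, E) x :=
  nabla.deriv (fun x => w.sharp x (α x)) Z

/-- The curvature `C_D(α, β)Z = D_α D_β Z - D_β D_α Z - D_[α, β] Z` of a contravariant
connection `D` on `TM`, where `(M, w)` is a Poisson manifold and `[α, β]` is the bracket
of 1-forms defined by `w`. -/
def contravariantCurvature (w : ContravariantTwoTensor 𝓘(ℝ, E) M)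
    (D : (∀ x : M, CotangentSpace E x) → (∀ x : M, TangentSpace 𝓘(ℝ, E) x) →
      ∀ x : M, TangentSpace 𝓘(ℝ, E) x)
    (α β : ∀ x : M, CotangentSpace E x) (Z : ∀ x : M, TangentSpace 𝓘(ℝ, E) x) :
    ∀ x : M, TangentSpace 𝓘(ℝ, E) x :=
  D α (D β Z) - D β (D α Z) - D (oneFormBracket w α β) Z

/-! ### The cotangent bundle and horizontal lifts -/

/-- The total space of the cotangent bundle `T*M`. It is a manifold through the charts
`(x, p) ↦ (xⁱ, pᵢ)` induced by the charts of `M`. -/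
abbrev CotangentBundle (E : Type*) [NormedAddCommGroup E] [NormedSpace ℝ E]
    (M : Type*) [TopologicalSpace M] [ChartedSpace E M] : Type _ :=
  TotalSpace (E →L[ℝ] ℝ) (CotangentSpace E : M → Type _)

/-- The model with corners of the manifold `T*M`. -/
abbrev cotangentModel (E : Type*) [NormedAddCommGroup E] [NormedSpace ℝ E] :
    ModelWithCorners ℝ (E × (E →L[ℝ] ℝ)) (ModelProd E (E →L[ℝ] ℝ)) :=
  𝓘(ℝ, E).prod 𝓘(ℝ, E →L[ℝ] ℝ)

/-- The momentum `m(Z) : T*M → ℝ`, `m(Z)(x, p) = p(Z x)` of a vector field `Z`. -/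
def momentum (Z : ∀ x : M, TangentSpace 𝓘(ℝ, E) x) : CotangentBundle E M → ℝ :=
  fun u => u.2 (Z u.1)

/-- The coordinate vector field with constant components `e` in the preferred chart at `x₀`
(it is only relevant near `x₀`, and is set to `0` outside the domain of that chart). -/
def coordVectorField (x₀ : M) (e : E) : ∀ x : M, TangentSpace 𝓘(ℝ, E) x :=
  fun x => (trivializationAt E (TangentSpace 𝓘(ℝ, E) : M → Type _) x₀).symmL ℝ x e

theorem coordVectorField_mdifferentiableAt (x₀ : M) (e : E) :
    MDiffAt (T% (coordVectorField x₀ e)) x₀ := by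
  have hx : x₀ ∈ (trivializationAt E (TangentSpace 𝓘(ℝ, E) : M → Type _) x₀).baseSet :=
    FiberBundle.mem_baseSet_trivializationAt' x₀
  rw [mdifferentiableAt_section]
  refine (mdifferentiableAt_const (c := e)).congr_of_eventuallyEq ?_
  filter_upwards [(trivializationAt E (TangentSpace 𝓘(ℝ, E) : M → Type _) x₀).open_baseSet.mem_nhds
    hx] with y hy
  have h := (trivializationAt E (TangentSpace 𝓘(ℝ, E) : M → Type _) x₀).continuousLinearMapAt_symmL
    (R := ℝ) hy e
  rwa [Trivialization.continuousLinearMapAt_apply, Trivialization.linearMapAt_apply, if_pos hy] at h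

/-- For a covector `u` at `x` and `v ∈ T_x M`, the covector `e ↦ u(∇_v ∂_e)`, where `∂_e` is the
coordinate vector field with components `e` in the preferred chart at `x`.
In components this is `pₖ Γᵏᵢⱼ vⁱ dxʲ = - Nᵢⱼ vⁱ dxʲ`, where `∇_∂ᵢ ∂ⱼ = Γᵏᵢⱼ ∂ₖ`. -/
def verticalPart (nabla : LinearConnection E M) (u : CotangentBundle E M) :
    TangentSpace 𝓘(ℝ, E) u.1 →ₗ[ℝ] (E →L[ℝ] ℝ) where
  toFun v := LinearMap.toContinuousLinearMap
    { toFun := fun e => u.2 (nabla (coordVectorField u.1 e) u.1 v)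
      map_add' := fun e e' => by
        have h : coordVectorField u.1 (e + e') = coordVectorField u.1 e + coordVectorField u.1 e' := by
          funext y; exact map_add _ e e'
        rw [h, nabla.isCovariantDerivativeOnUniv.add (coordVectorField_mdifferentiableAt u.1 e)
          (coordVectorField_mdifferentiableAt u.1 e')]
        exact map_add u.2 _ _
      map_smul' := fun c e => by
        have h : coordVectorField u.1 (c • e) = c • coordVectorField u.1 e := by
          funext y; exact map_smul _ c e
        rw [h, nabla.isCovariantDerivativeOnUniv.smul_const c
          (coordVectorField_mdifferentiableAt u.1 e)]
        exact map_smul u.2 _ _ }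
  map_add' v v' := by
    ext e
    change u.2 (nabla (coordVectorField u.1 e) u.1 (v + v')) = _
    rw [map_add, map_add]; rfl
  map_smul' c v := by
    ext e
    change u.2 (nabla (coordVectorField u.1 e) u.1 (c • v)) = _
    rw [map_smul, map_smul]; rfl

/-- The horizontal lift `T_x M → T_u (T*M)` at `u ∈ T*_x M` of the connection on `T*M` defined
by `∇`: in the natural coordinates of `T*M` it maps
`∂/∂xⁱ` to `δ/δxⁱ = ∂/∂xⁱ - Nᵢⱼ ∂/∂pⱼ` with `Nᵢⱼ = - pₖ Γᵏᵢⱼ`.  -/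
def horizontalLift (nabla : LinearConnection E M) (u : CotangentBundle E M) :
    TangentSpace 𝓘(ℝ, E) u.1 →L[ℝ] TangentSpace (cotangentModel E) u :=
  LinearMap.toContinuousLinearMap
    ((LinearMap.prod LinearMap.id (verticalPart nabla u) :
      TangentSpace 𝓘(ℝ, E) u.1 →ₗ[ℝ] E × (E →L[ℝ] ℝ)))

/-- The horizontal lift `w^H = ½ wⁱʲ δ/δxⁱ ∧ δ/δxʲ` of `w` to `T*M` with respect to `∇`. -/
def horizontalLiftTensor (nabla : LinearConnection E M) (w : ContravariantTwoTensor 𝓘(ℝ, E) M) :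
    ContravariantTwoTensor (cotangentModel E) (CotangentBundle E M) :=
  fun u => (w u.1).compl₁₂
    (ContinuousLinearMap.precomp ℝ (horizontalLift nabla u)).toLinearMap
    (ContinuousLinearMap.precomp ℝ (horizontalLift nabla u)).toLinearMap

end Base

end

/-! ### Differentials and vector fields tested by globally defined functions -/

noncomputable section

section General

open Set Filter Topology VectorField

set_option linter.unusedSectionVars false

variable {E : Type*} [NormedAddCommGroup E] [NormedSpace ℝ E]
  {H : Type*} [TopologicalSpace H] {I : ModelWithCorners ℝ E H}
  {N : Type*} [TopologicalSpace N] [ChartedSpace H N]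

/-! Two families of functions on the cotangent bundle suffice: the pullbacks `f ∘ π` of functions on
`M`, and the momenta `m(Z)` of vector fields. By construction, the horizontal lift of `v`
differentiates `f ∘ π` to `df(v)` and `m(Z)` to `m(∇_v Z)`. Hence, for the bracket of `w^H`, `{f ∘
π, g ∘ π} = {f, g} ∘ π` and `{f ∘ π, m(Z)} = m(∇_{X_f} Z)`. With `X_{{f, g}} = [X_f, X_g]` on the
Poisson manifold `M`, the Jacobiator of `f ∘ π`, `g ∘ π`, `m(Z)` is `-m(R(X_f, X_g) Z)`
(`jacobiator_comp_proj_momentum`). If `w^H` is Poisson this vanishes for all covectors, so `R(X_f,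
X_g) Z = 0`.

Conversely, the Jacobiator at `u` depends only on the differentials of its arguments at `u`
(`jacobiator_congr`). Any such differential is that of some `f ∘ π + m(Y)` with `∇Y = 0` at the base
point (`exists_mvfderiv_eq_comp_proj_add_momentum`). Expanding by additivity leaves three kinds of
terms. With pullbacks only, the Jacobi identity of `w` applies; with one momentum, the term is a
curvature, zero by hypothesis. With two or more momenta, two arguments have zero horizontal
differential at `u`. Their bracket is locally a sum of products of horizontal derivatives, all
factors of which vanish at `u`, so it is critical there and the Jacobiator is zero, even without any
curvature assumption.

The contravariant condition is the same one: `[df, dg]_w = d{f, g}` gives `C_D(df, dg) = R(X_f,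
X_g)`. Since `C_D` is tensorial in the 1-forms and every covector at a point is the differential of
a global function, exact forms detect `C_D` entirely (`contravariantCurvature_eq_zero_iff`). -/

theorem Filter.EventuallyEq.mvfderiv_eq {f g : N → ℝ} {x : N} (h : f =ᶠ[𝓝 x] g) :
    mvfderiv I f x = mvfderiv I g x := by
  unfold mvfderiv
  rw [h.mfderiv_eq]
  ext v
  rfl

variable [FiniteDimensional ℝ E] [IsManifold I ∞ N]

/-- Multiplication by a bump function equal to `1` near `x₀` globalizes `g`. Hausdorffness makes the
extension by zero smooth. Brackets are tested on global functions only, so local coordinates must be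
replaced by such extensions. -/
theorem exists_contMDiff_eventuallyEq [T2Space N] (x₀ : N) {g : N → ℝ}
    (hg : ContMDiffOn I 𝓘(ℝ, ℝ) ∞ g (chartAt H x₀).source) :
    ∃ f : N → ℝ, ContMDiff I 𝓘(ℝ, ℝ) ∞ f ∧ f =ᶠ[𝓝 x₀] g := by
  obtain ⟨χ⟩ : Nonempty (SmoothBumpFunction I x₀) := inferInstance
  refine ⟨fun x => χ x • g x, χ.contMDiff_smul hg, ?_⟩
  filter_upwards [χ.eventuallyEq_one] with x hx
  simp [hx]

/-- Any linear coordinate of a chart agrees near the centre with a smooth function. -/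
theorem exists_contMDiff_eventuallyEq_extChartAt [T2Space N] (x₀ : N) (l : E →L[ℝ] ℝ) :
    ∃ f : N → ℝ, ContMDiff I 𝓘(ℝ, ℝ) ∞ f ∧ f =ᶠ[𝓝 x₀] fun x => l (extChartAt I x₀ x) :=
  exists_contMDiff_eventuallyEq x₀
    (l.contDiff.contMDiff.comp_contMDiffOn (contMDiffOn_extChartAt (I := I) (x := x₀)))

theorem mvfderiv_clm_comp_extChartAt {x₀ x : N} (l : E →L[ℝ] ℝ) (hx : x ∈ (chartAt H x₀).source)
    (v : TangentSpace I x) :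
    mvfderiv I (fun y => l (extChartAt I x₀ y)) x v =
      l (mfderiv I 𝓘(ℝ, E) (extChartAt I x₀) x v) := by
  have h : MDifferentiableAt I 𝓘(ℝ, E) (extChartAt I x₀) x := mdifferentiableAt_extChartAt hx
  have := mfderiv_comp_apply (I := I) (I' := 𝓘(ℝ, E)) (I'' := 𝓘(ℝ, ℝ)) x
    (l.differentiableAt.mdifferentiableAt) h v
  change mfderiv I 𝓘(ℝ, ℝ) (l ∘ extChartAt I x₀) x v = _
  rw [this, mfderiv_eq_fderiv, l.fderiv]
  rfl

/-- The differential `A` of the chart at `x` is invertible, so the linear coordinate `a ∘ A⁻¹`, cut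
off away from `x`, has differential `a`. -/
theorem exists_mvfderiv_eq [T2Space N] (x : N) (a : TangentSpace I x →L[ℝ] ℝ) :
    ∃ f : N → ℝ, ContMDiff I 𝓘(ℝ, ℝ) ∞ f ∧ mvfderiv I f x = a := by
  have hx : x ∈ (chartAt H x).source := mem_chart_source H x
  let A : TangentSpace I x →L[ℝ] E := mfderiv I 𝓘(ℝ, E) (extChartAt I x) x
  have hA : A.IsInvertible := isInvertible_mfderiv_extChartAt (mem_extChartAt_source x)
  obtain ⟨f, hf, hfe⟩ := exists_contMDiff_eventuallyEq_extChartAt (I := I) x (a ∘L A.inverse)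
  refine ⟨f, hf, ?_⟩
  rw [hfe.mvfderiv_eq]
  ext v
  rw [mvfderiv_clm_comp_extChartAt _ hx]
  obtain ⟨B, hB⟩ := hA
  have : A.inverse (A v) = v := by rw [← hB]; simp
  exact congrArg a this

theorem eq_of_forall_mvfderiv_eq [T2Space N] {x : N} {v v' : TangentSpace I x}
    (h : ∀ f : N → ℝ, ContMDiff I 𝓘(ℝ, ℝ) ∞ f → mvfderiv I f x v = mvfderiv I f x v') : v = v' := by
  have key : ∀ a : E →L[ℝ] ℝ, a v = a v' := fun a => by
    obtain ⟨f, hf, hfa⟩ := exists_mvfderiv_eq (I := I) x a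
    have := h f hf
    rwa [hfa] at this
  exact (SeparatingDual.eq_iff_forall_dual_eq (R := ℝ) (V := E)).2 key

/-- The function is the fibre component of the tangent map of `f` composed with the section `V`. -/
theorem ContMDiff.contMDiffAt_mvfderiv_apply {f : N → ℝ} {V : ∀ x : N, TangentSpace I x} {x₀ : N}
    (hf : ContMDiff I 𝓘(ℝ, ℝ) ∞ f) (hV : ContMDiffAt I I.tangent ∞ (T% V) x₀) :
    ContMDiffAt I 𝓘(ℝ, ℝ) ∞ (fun x => mvfderiv I f x (V x)) x₀ := by
  have h1 : ContMDiff I.tangent 𝓘(ℝ, ℝ).tangent ∞ (tangentMap I 𝓘(ℝ, ℝ) f) :=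
    hf.contMDiff_tangentMap (by simp)
  have h2 := (contMDiff_snd_tangentBundle_modelSpace ℝ 𝓘(ℝ, ℝ)).comp h1
  exact ContMDiffAt.comp (g := fun v : TangentBundle I N => (tangentMap I 𝓘(ℝ, ℝ) f v).2) x₀
    (h2 _) hV

theorem ContMDiff.mdifferentiableAt_mvfderiv_apply {f : N → ℝ} {V : ∀ x : N, TangentSpace I x}
    {x₀ : N} (hf : ContMDiff I 𝓘(ℝ, ℝ) ∞ f)
    (hV : MDifferentiableAt I I.tangent (T% V) x₀) :
    MDifferentiableAt I 𝓘(ℝ, ℝ) (fun x => mvfderiv I f x (V x)) x₀ := by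
  have h1 : ContMDiff I.tangent 𝓘(ℝ, ℝ).tangent ∞ (tangentMap I 𝓘(ℝ, ℝ) f) :=
    hf.contMDiff_tangentMap (by simp)
  have h2 := (contMDiff_snd_tangentBundle_modelSpace ℝ 𝓘(ℝ, ℝ)).comp h1
  exact MDifferentiableAt.comp (g := fun v : TangentBundle I N => (tangentMap I 𝓘(ℝ, ℝ) f v).2) x₀
    ((h2 _).mdifferentiableAt (by simp)) hV

theorem eventually_trivializationAt_snd_eq (V : ∀ x : N, TangentSpace I x) (x₀ : N) :
    ∀ᶠ x in 𝓝 x₀, (trivializationAt E (TangentSpace I : N → Type _) x₀ ⟨x, V x⟩).2 =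
      mfderiv I 𝓘(ℝ, E) (extChartAt I x₀) x (V x) := by
  filter_upwards [(chartAt H x₀).open_source.mem_nhds (mem_chart_source H x₀)] with x hx
  have hx' : x ∈ (trivializationAt E (TangentSpace I : N → Type _) x₀).baseSet := by simpa using hx
  have h1 := Trivialization.continuousLinearMapAt_apply ℝ
    (trivializationAt E (TangentSpace I : N → Type _) x₀) (b := x)
  have h2 := congrFun h1 (V x)
  rw [Trivialization.linearMapAt_apply, if_pos hx'] at h2
  refine h2.symm.trans ?_
  exact DFunLike.congr_fun (TangentBundle.continuousLinearMapAt_trivializationAt hx) (V x)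

/-- A vector field is smooth at a point if it maps enough local coordinates to smooth functions. -/
theorem contMDiffAt_vectorField_of_coordinates {V : ∀ x : N, TangentSpace I x} {x₀ : N}
    (h : ∀ l : E →L[ℝ] ℝ, ∃ f : N → ℝ, f =ᶠ[𝓝 x₀] (fun x => l (extChartAt I x₀ x)) ∧
      ContMDiffAt I 𝓘(ℝ, ℝ) ∞ (fun x => mvfderiv I f x (V x)) x₀) :
    ContMDiffAt I I.tangent ∞ (T% V) x₀ := by
  rw [contMDiffAt_section]
  let b := Module.finBasis ℝ E
  have key : ∀ i, ContMDiffAt I 𝓘(ℝ, ℝ) ∞ (fun x => b.coord i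
      (trivializationAt E (TangentSpace I : N → Type _) x₀ ⟨x, V x⟩).2) x₀ := by
    intro i
    obtain ⟨f, hf, hfV⟩ := h (LinearMap.toContinuousLinearMap (b.coord i))
    refine hfV.congr_of_eventuallyEq ?_
    filter_upwards [eventually_trivializationAt_snd_eq V x₀, hf.eventuallyEq_nhds,
      (chartAt H x₀).open_source.mem_nhds (mem_chart_source H x₀)] with x hx hfx hxs
    rw [hx, hfx.mvfderiv_eq, mvfderiv_clm_comp_extChartAt _ hxs]
    rfl
  have h2 : ContMDiffAt I 𝓘(ℝ, E) ∞ (fun x => ∑ i, b.coord i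
      (trivializationAt E (TangentSpace I : N → Type _) x₀ ⟨x, V x⟩).2 • b i) x₀ :=
    contMDiffAt_finsetSum fun i _ => (key i).smul contMDiffAt_const
  refine h2.congr_of_eventuallyEq (Eventually.of_forall fun x => ?_)
  exact (b.sum_repr _).symm

theorem mdifferentiableAt_vectorField_of_coordinates {V : ∀ x : N, TangentSpace I x} {x₀ : N}
    (h : ∀ l : E →L[ℝ] ℝ, ∃ f : N → ℝ, f =ᶠ[𝓝 x₀] (fun x => l (extChartAt I x₀ x)) ∧
      MDifferentiableAt I 𝓘(ℝ, ℝ) (fun x => mvfderiv I f x (V x)) x₀) :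
    MDifferentiableAt I I.tangent (T% V) x₀ := by
  rw [mdifferentiableAt_section]
  let b := Module.finBasis ℝ E
  have key : ∀ i, MDifferentiableAt I 𝓘(ℝ, ℝ) (fun x => b.coord i
      (trivializationAt E (TangentSpace I : N → Type _) x₀ ⟨x, V x⟩).2) x₀ := by
    intro i
    obtain ⟨f, hf, hfV⟩ := h (LinearMap.toContinuousLinearMap (b.coord i))
    refine hfV.congr_of_eventuallyEq ?_
    filter_upwards [eventually_trivializationAt_snd_eq V x₀, hf.eventuallyEq_nhds,
      (chartAt H x₀).open_source.mem_nhds (mem_chart_source H x₀)] with x hx hfx hxs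
    rw [hx, hfx.mvfderiv_eq, mvfderiv_clm_comp_extChartAt _ hxs]
    rfl
  have h2 : MDifferentiableAt I 𝓘(ℝ, E) (fun x => ∑ i, b.coord i
      (trivializationAt E (TangentSpace I : N → Type _) x₀ ⟨x, V x⟩).2 • b i) x₀ := by
    have := MDifferentiableAt.sum (t := Finset.univ) fun i _ =>
      (key i).smul (mdifferentiableAt_const (c := b i))
    convert this using 1
    ext x
    simp
  refine h2.congr_of_eventuallyEq (Eventually.of_forall fun x => ?_)
  exact (b.sum_repr _).symm

/-- The Lie bracket of vector fields is the commutator of the corresponding derivations. -/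
theorem mvfderiv_mlieBracket [I.Boundaryless] {f : N → ℝ} (hf : ContMDiff I 𝓘(ℝ, ℝ) ∞ f)
    {V W : ∀ x : N, TangentSpace I x} {x : N}
    (hV : MDifferentiableAt I I.tangent (T% V) x) (hW : MDifferentiableAt I I.tangent (T% W) x) :
    mvfderiv I f x (mlieBracket I V W x) =
      mvfderiv I (fun y => mvfderiv I f y (W y)) x (V x) -
        mvfderiv I (fun y => mvfderiv I f y (V y)) x (W x) := by
  have hcE : CompleteSpace E := FiniteDimensional.complete ℝ E
  have : IsManifold I 2 N := IsManifold.of_le (n := ∞) (by exact ENat.LEInfty.out)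
  set φ := extChartAt I x with hφ
  have hx : φ x ∈ φ.target := mem_extChartAt_target x
  have hxx : φ.symm (φ x) = x := extChartAt_to_inv x
  have hr : range I = univ := I.range_eq_univ
  have hfd : ∀ y, MDifferentiableAt I 𝓘(ℝ, ℝ) f y := fun y => (hf y).mdifferentiableAt (by simp)
  -- The computation is transported to the chart at `x`, where the bracket is the usual one of
  -- vector fields on `E`.
  have chain : ∀ {g : N → ℝ} {y : E}, y ∈ φ.target →
      MDifferentiableAt I 𝓘(ℝ, ℝ) g (φ.symm y) → ∀ v : E, fderiv ℝ (g ∘ φ.symm) y v =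
        mvfderiv I g (φ.symm y) (mfderivWithin 𝓘(ℝ, E) I φ.symm (range I) y v) := by
    intro g y hy hg v
    have h1 : MDifferentiableAt 𝓘(ℝ, E) I φ.symm y := by
      have := mdifferentiableWithinAt_extChartAt_symm (I := I) hy
      rwa [hr, mdifferentiableWithinAt_univ] at this
    rw [hr, mfderivWithin_univ, ← mfderiv_eq_fderiv]
    exact mfderiv_comp_apply y hg h1 v
  have hcenter : ∀ {g : N → ℝ}, MDifferentiableAt I 𝓘(ℝ, ℝ) g x → ∀ v : E,
      fderiv ℝ (g ∘ φ.symm) (φ x) v = mvfderiv I g x v := by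
    intro g hg v
    have h1 := chain hx (g := g) (by rwa [hxx]) v
    rw [h1, mfderivWithin_range_extChartAt_symm]
    exact congrArg (fun z : N => (mvfderiv I g z : E →L[ℝ] ℝ) v) hxx
  -- `P U` is the field `U` read in the chart; at the centre it has the same value as `U`, because
  -- the chart's own differential there is the identity.
  obtain ⟨P, hP⟩ : ∃ P : (∀ x : N, TangentSpace I x) → E → E,
      P = fun U => (mpullbackWithin 𝓘(ℝ, E) I φ.symm U (range I) : E → E) := ⟨_, rfl⟩
  have hsymm : ∀ (U : ∀ x : N, TangentSpace I x) {y : E}, y ∈ φ.target →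
      mfderivWithin 𝓘(ℝ, E) I φ.symm (range I) y (P U y) = U (φ.symm y) := by
    intro U y hy
    obtain ⟨B, hB⟩ := isInvertible_mfderivWithin_extChartAt_symm (I := I) hy
    simp only [hP]
    rw [mpullbackWithin_apply, ← hB, ContinuousLinearMap.inverse_equiv]
    exact B.apply_symm_apply _
  have hval : ∀ (U : ∀ x : N, TangentSpace I x), P U (φ x) = (U x : E) := by
    intro U
    have h1 := hsymm U hx
    rw [mfderivWithin_range_extChartAt_symm] at h1
    exact h1.trans (congrArg (fun z : N => (U z : E)) hxx)
  have hdiff : ∀ {U : ∀ x : N, TangentSpace I x}, MDifferentiableAt I I.tangent (T% U) x →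
      DifferentiableAt ℝ (P U) (φ x) := by
    intro U hU
    have h1 : DifferentiableWithinAt ℝ (P U) (φ.symm ⁻¹' univ ∩ range I) (φ x) := by
      rw [hP]
      exact (mdifferentiableWithinAt_univ.2 hU).differentiableWithinAt_mpullbackWithin_vectorField
    rwa [preimage_univ, univ_inter, hr, differentiableWithinAt_univ] at h1
  have hfs : ContDiffAt ℝ ∞ (f ∘ φ.symm) (φ x) := by
    have h1 := (contMDiffWithinAt_extChartAt_symm_range (I := I) (n := ∞) x hx)
    rw [hr, contMDiffWithinAt_univ] at h1
    exact ((hf _).comp _ h1).contDiffAt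
  have hD : DifferentiableAt ℝ (fderiv ℝ (f ∘ φ.symm)) (φ x) :=
    (hfs.fderiv_right (m := 1) (by
    rw [one_add_one_eq_two]; exact ENat.LEInfty.out)).differentiableAt (by simp)
  have hsnd : IsSymmSndFDerivAt ℝ (f ∘ φ.symm) (φ x) := hfs.isSymmSndFDerivAt <| by
    rw [minSmoothness_of_isRCLikeNormedField]
    exact ENat.LEInfty.out
  have htarget : ∀ᶠ y in 𝓝 (φ x), y ∈ φ.target := by
    have := extChartAt_target_mem_nhdsWithin (I := I) x
    rwa [hr, nhdsWithin_univ] at this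
  -- The derivative of `U(f)` splits into a Hessian term and a term with the derivative of `U`. In
  -- the commutator the Hessian terms cancel by symmetry, and the rest is `df` of the bracket.
  have second : ∀ {U : ∀ x : N, TangentSpace I x}, MDifferentiableAt I I.tangent (T% U) x →
      ∀ v : E, mvfderiv I (fun y => mvfderiv I f y (U y)) x v =
        fderiv ℝ (fderiv ℝ (f ∘ φ.symm)) (φ x) v (P U (φ x)) +
        fderiv ℝ (f ∘ φ.symm) (φ x) (fderiv ℝ (P U) (φ x) v) := by
    intro U hU v
    rw [← hcenter (hf.mdifferentiableAt_mvfderiv_apply hU)]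
    have h1 : ((fun y => mvfderiv I f y (U y)) ∘ φ.symm) =ᶠ[𝓝 (φ x)] fun y =>
        fderiv ℝ (f ∘ φ.symm) y (P U y) := by
      filter_upwards [htarget] with y hy
      rw [chain hy (hfd _), hsymm U hy]
      rfl
    rw [h1.fderiv_eq, fderiv_clm_apply hD (hdiff hU)]
    simp only [add_apply, ContinuousLinearMap.comp_apply, ContinuousLinearMap.flip_apply]
    exact add_comm _ _
  have hbr : (mlieBracket I V W x : E) = lieBracket ℝ (P V) (P W) (φ x) := by
    have hw : lieBracketWithin ℝ (P V) (P W) (range I) (φ x) = lieBracket ℝ (P V) (P W) (φ x) := by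
      rw [hr, lieBracketWithin_univ]
    rw [← mlieBracketWithin_univ, mlieBracketWithin_apply, preimage_univ, univ_inter,
      mfderiv_extChartAt_self, ← hw, hP]
    change (ContinuousLinearMap.id ℝ E).inverse _ = _
    rw [ContinuousLinearMap.inverse_id, ContinuousLinearMap.id_apply]
  have h1 := second hW (V x)
  have h2 := second hV (W x)
  have h3 := hcenter (hfd x) (lieBracket ℝ (P V) (P W) (φ x))
  rw [hval] at h1 h2
  have h4 := hsnd.eq (V x : E) (W x : E)
  have h5 : mvfderiv I f x (mlieBracket I V W x) = fderiv ℝ (f ∘ φ.symm) (φ x)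
      (fderiv ℝ (P W) (φ x) (V x : E)) - fderiv ℝ (f ∘ φ.symm) (φ x)
      (fderiv ℝ (P V) (φ x) (W x : E)) :=
    (congrArg (mvfderiv I f x : E →L[ℝ] ℝ) hbr).trans
      (h3.symm.trans (by rw [lieBracket, map_sub, hval, hval]))
  refine h5.trans ?_
  refine Eq.trans ?_ (congrArg₂ (fun a b : ℝ => a - b) h1 h2).symm
  simp only [h4]
  ring

end General
end

/-! ### The Jacobiator of a bivector field and its tensoriality -/

noncomputable section

section Jacobiator

open Set Filter Topology VectorField

set_option linter.unusedSectionVars false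

variable {E : Type*} [NormedAddCommGroup E] [NormedSpace ℝ E] [FiniteDimensional ℝ E]
  {H : Type*} [TopologicalSpace H] {I : ModelWithCorners ℝ E H}
  {N : Type*} [TopologicalSpace N] [ChartedSpace H N]

/-- Reflexivity in finite dimension. It yields Hamiltonian vector fields on any manifold and, on the
cotangent bundle, turns a linear form on the fibre into a vector of `E`. -/
theorem exists_apply_eq_of_bidual (L : (E →L[ℝ] ℝ) →ₗ[ℝ] ℝ) : ∃ e : E, ∀ c, c e = L c := by
  let b := Module.finBasis ℝ E
  refine ⟨∑ i, L (LinearMap.toContinuousLinearMap (b.coord i)) • b i, fun c => ?_⟩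
  have hc : c = ∑ i, c (b i) • LinearMap.toContinuousLinearMap (b.coord i) := by
    refine ContinuousLinearMap.coe_injective (b.ext fun j => ?_)
    simp [Finsupp.single_apply]
  conv_rhs => rw [hc]
  simp only [map_sum, map_smul, smul_eq_mul]
  exact Finset.sum_congr rfl fun i _ => mul_comm _ _

namespace ContravariantTwoTensor

variable {W : ContravariantTwoTensor I N}

theorem IsBivectorField.skew (hW : W.IsBivectorField) (x : N) (a b : TangentSpace I x →L[ℝ] ℝ) :
    W x a b = -W x b a := by
  have h := hW.alternating x (a + b)
  simp only [map_add, LinearMap.add_apply, hW.alternating] at h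
  linarith

theorem IsBivectorField.bracket_swap (hW : W.IsBivectorField) (f g : N → ℝ) :
    W.bracket f g = -W.bracket g f :=
  funext fun _ => hW.skew _ _ _

theorem bracket_neg_left (f g : N → ℝ) : W.bracket (-f) g = -W.bracket f g := by
  ext x
  simp [bracket, mvfderiv_neg]

theorem bracket_neg_right (f g : N → ℝ) : W.bracket f (-g) = -W.bracket f g := by
  ext x
  simp [bracket, mvfderiv_neg]

theorem bracket_add_left {f f' : N → ℝ} (hf : ContMDiff I 𝓘(ℝ, ℝ) ∞ f)
    (hf' : ContMDiff I 𝓘(ℝ, ℝ) ∞ f') (g : N → ℝ) :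
    W.bracket (f + f') g = W.bracket f g + W.bracket f' g := by
  ext x
  simp [bracket, mvfderiv_add ((hf x).mdifferentiableAt (by simp))
    ((hf' x).mdifferentiableAt (by simp))]

theorem bracket_add_right {g g' : N → ℝ} (hg : ContMDiff I 𝓘(ℝ, ℝ) ∞ g)
    (hg' : ContMDiff I 𝓘(ℝ, ℝ) ∞ g') (f : N → ℝ) :
    W.bracket f (g + g') = W.bracket f g + W.bracket f g' := by
  ext x
  simp [bracket, mvfderiv_add ((hg x).mdifferentiableAt (by simp))
    ((hg' x).mdifferentiableAt (by simp))]

/-- The vector field `X` with `g ↦ dg(X)` equal to `g ↦ {f, g}`. -/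
def IsHamiltonian (W : ContravariantTwoTensor I N) (f : N → ℝ) (X : ∀ x : N, TangentSpace I x) :
    Prop :=
  ∀ (x : N) (b : TangentSpace I x →L[ℝ] ℝ), b (X x) = W x (mvfderiv I f x) b

theorem exists_isHamiltonian (W : ContravariantTwoTensor I N) (f : N → ℝ) :
    ∃ X : ∀ x : N, TangentSpace I x, W.IsHamiltonian f X := by
  let L : N → (E →L[ℝ] ℝ) →ₗ[ℝ] ℝ := fun x => W x (mvfderiv I f x)
  choose X hX using fun x => exists_apply_eq_of_bidual (L x)
  exact ⟨X, hX⟩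

variable [IsManifold I ∞ N] [T2Space N]

/-- The components of `X` are locally the brackets of `f` with globalized coordinates, which are
smooth by assumption. -/
theorem IsBivectorField.contMDiff_of_isHamiltonian (hW : W.IsBivectorField) {f : N → ℝ}
    (hf : ContMDiff I 𝓘(ℝ, ℝ) ∞ f) {X : ∀ x : N, TangentSpace I x} (hX : W.IsHamiltonian f X) :
    ContMDiff I I.tangent ∞ (T% X) := by
  intro x₀
  refine contMDiffAt_vectorField_of_coordinates fun l => ?_
  obtain ⟨g, hg, hgl⟩ := exists_contMDiff_eventuallyEq_extChartAt (I := I) x₀ l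
  refine ⟨g, hgl, (hW.smooth f g hf hg x₀).congr_of_eventuallyEq (Eventually.of_forall fun x => ?_)⟩
  exact hX x _

/-- The Jacobiator of the bracket defined by `W`. -/
def jacobiator (W : ContravariantTwoTensor I N) (f g h : N → ℝ) : N → ℝ :=
  W.bracket (W.bracket f g) h + W.bracket (W.bracket g h) f + W.bracket (W.bracket h f) g

theorem jacobiator_cyclic (f g h : N → ℝ) : W.jacobiator f g h = W.jacobiator g h f := by
  simp only [jacobiator]; ring

theorem IsBivectorField.jacobiator_add_left (hW : W.IsBivectorField) {f f' g h : N → ℝ}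
    (hf : ContMDiff I 𝓘(ℝ, ℝ) ∞ f) (hf' : ContMDiff I 𝓘(ℝ, ℝ) ∞ f')
    (hg : ContMDiff I 𝓘(ℝ, ℝ) ∞ g) (hh : ContMDiff I 𝓘(ℝ, ℝ) ∞ h) :
    W.jacobiator (f + f') g h = W.jacobiator f g h + W.jacobiator f' g h := by
  simp only [jacobiator, bracket_add_left hf hf', bracket_add_right hf hf',
    bracket_add_left (hW.smooth _ _ hf hg) (hW.smooth _ _ hf' hg),
    bracket_add_left (hW.smooth _ _ hh hf) (hW.smooth _ _ hh hf')]
  ring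

/-- Primed arguments are rotated to the end of each term, so that for pullbacks plus momenta every
summand has the shape required by one of the vanishing lemmas. -/
theorem IsBivectorField.jacobiator_add_add_add (hW : W.IsBivectorField) {f f' g g' h h' : N → ℝ}
    (hf : ContMDiff I 𝓘(ℝ, ℝ) ∞ f) (hf' : ContMDiff I 𝓘(ℝ, ℝ) ∞ f')
    (hg : ContMDiff I 𝓘(ℝ, ℝ) ∞ g) (hg' : ContMDiff I 𝓘(ℝ, ℝ) ∞ g')
    (hh : ContMDiff I 𝓘(ℝ, ℝ) ∞ h) (hh' : ContMDiff I 𝓘(ℝ, ℝ) ∞ h') :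
    W.jacobiator (f + f') (g + g') (h + h') =
      W.jacobiator f g h + W.jacobiator f g h' + W.jacobiator g h f' + W.jacobiator h f g' +
        W.jacobiator f g' h' + W.jacobiator g h' f' + W.jacobiator h f' g' +
          W.jacobiator f' g' h' := by
  have key : ∀ {k l : N → ℝ}, ContMDiff I 𝓘(ℝ, ℝ) ∞ k → ContMDiff I 𝓘(ℝ, ℝ) ∞ l →
      W.jacobiator k l (h + h') = W.jacobiator k l h + W.jacobiator k l h' := fun {k l} hk hl => by
    rw [← jacobiator_cyclic (h + h') k l, hW.jacobiator_add_left hh hh' hk hl,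
      jacobiator_cyclic h, jacobiator_cyclic h']
  rw [hW.jacobiator_add_left hf hf' (hg.add hg') (hh.add hh'), jacobiator_cyclic f,
    jacobiator_cyclic f', hW.jacobiator_add_left hg hg' (hh.add hh') hf,
    hW.jacobiator_add_left hg hg' (hh.add hh') hf', ← jacobiator_cyclic f g,
    ← jacobiator_cyclic f g', ← jacobiator_cyclic f' g, ← jacobiator_cyclic f' g', key hf hg,
    key hf hg', key hf' hg, key hf' hg', ← jacobiator_cyclic h f g', jacobiator_cyclic f' g h,
    jacobiator_cyclic f' g h', ← jacobiator_cyclic h f' g']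
  abel

theorem jacobiator_neg_left (f g h : N → ℝ) :
    W.jacobiator (-f) g h = -W.jacobiator f g h := by
  simp only [jacobiator, bracket_neg_left, bracket_neg_right]
  ring

variable [I.Boundaryless]

/-- The Jacobiator is tensorial: it vanishes where the differential of an argument does. -/
theorem IsBivectorField.jacobiator_eq_zero (hW : W.IsBivectorField) {f g h : N → ℝ}
    (hf : ContMDiff I 𝓘(ℝ, ℝ) ∞ f) (hg : ContMDiff I 𝓘(ℝ, ℝ) ∞ g)
    (hh : ContMDiff I 𝓘(ℝ, ℝ) ∞ h) {x : N} (hx : mvfderiv I f x = 0) :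
    W.jacobiator f g h x = 0 := by
  obtain ⟨X, hX⟩ := W.exists_isHamiltonian g
  obtain ⟨Y, hY⟩ := W.exists_isHamiltonian h
  have hXs := hW.contMDiff_of_isHamiltonian hg hX
  have hYs := hW.contMDiff_of_isHamiltonian hh hY
  -- As `df` kills `[X_h, X_g]` at `x`, this reads `{h, {g, f}} = {g, {h, f}}` there. These are, up
  -- to sign, the two Jacobiator terms that differentiate `f` twice.
  have h1 := mvfderiv_mlieBracket hf ((hYs x).mdifferentiableAt (by simp))
    ((hXs x).mdifferentiableAt (by simp))
  have h2 : (fun y => mvfderiv I f y (X y)) = W.bracket g f := funext fun y => hX y _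
  have h3 : (fun y => mvfderiv I f y (Y y)) = W.bracket h f := funext fun y => hY y _
  rw [hx, h2, h3, hX, hY] at h1
  have h4 : W.bracket (W.bracket g h) f x = 0 := by simp [bracket, hx]
  have h5 : W.bracket (W.bracket f g) h x = W.bracket h (W.bracket g f) x := by
    rw [hW.bracket_swap f g, hW.bracket_swap, bracket_neg_right, neg_neg]
  have h6 : W.bracket (W.bracket h f) g x = -W.bracket g (W.bracket h f) x := by
    rw [hW.bracket_swap]; rfl
  simp only [jacobiator, Pi.add_apply, h4, h5, h6]
  have h7 : (0 : ℝ) = W.bracket h (W.bracket g f) x - W.bracket g (W.bracket h f) x := h1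
  linarith

theorem IsBivectorField.jacobiator_congr_left (hW : W.IsBivectorField) {f f' g h : N → ℝ}
    (hf : ContMDiff I 𝓘(ℝ, ℝ) ∞ f) (hf' : ContMDiff I 𝓘(ℝ, ℝ) ∞ f')
    (hg : ContMDiff I 𝓘(ℝ, ℝ) ∞ g) (hh : ContMDiff I 𝓘(ℝ, ℝ) ∞ h) {x : N}
    (hx : mvfderiv I f x = mvfderiv I f' x) :
    W.jacobiator f g h x = W.jacobiator f' g h x := by
  have hn : ContMDiff I 𝓘(ℝ, ℝ) ∞ (-f') := hf'.neg
  have h1 := hW.jacobiator_eq_zero (f := f + -f') (hf.add hn) hg hh (x := x) (by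
    rw [mvfderiv_add ((hf x).mdifferentiableAt (by simp))
      ((hn x).mdifferentiableAt (by simp)), mvfderiv_neg, hx, add_neg_cancel])
  rw [hW.jacobiator_add_left hf hn hg hh, jacobiator_neg_left] at h1
  simpa [add_neg_eq_zero] using h1

theorem IsBivectorField.jacobiator_congr (hW : W.IsBivectorField) {f f' g g' h h' : N → ℝ}
    (hf : ContMDiff I 𝓘(ℝ, ℝ) ∞ f) (hf' : ContMDiff I 𝓘(ℝ, ℝ) ∞ f')
    (hg : ContMDiff I 𝓘(ℝ, ℝ) ∞ g) (hg' : ContMDiff I 𝓘(ℝ, ℝ) ∞ g')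
    (hh : ContMDiff I 𝓘(ℝ, ℝ) ∞ h) (hh' : ContMDiff I 𝓘(ℝ, ℝ) ∞ h') {x : N}
    (hfx : mvfderiv I f x = mvfderiv I f' x) (hgx : mvfderiv I g x = mvfderiv I g' x)
    (hhx : mvfderiv I h x = mvfderiv I h' x) :
    W.jacobiator f g h x = W.jacobiator f' g' h' x := by
  rw [hW.jacobiator_congr_left hf hf' hg hh hfx, jacobiator_cyclic,
    hW.jacobiator_congr_left hg hg' hh hf' hgx, jacobiator_cyclic,
    hW.jacobiator_congr_left hh hh' hf' hg' hhx, jacobiator_cyclic]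

/-- For a Poisson structure, `X_{f, g} = [X_f, X_g]`. -/
theorem IsPoisson.isHamiltonian_mlieBracket (hW : W.IsPoisson) {f g : N → ℝ}
    (hf : ContMDiff I 𝓘(ℝ, ℝ) ∞ f) (hg : ContMDiff I 𝓘(ℝ, ℝ) ∞ g)
    {X Y Z : ∀ x : N, TangentSpace I x} (hX : W.IsHamiltonian f X) (hY : W.IsHamiltonian g Y)
    (hZ : W.IsHamiltonian (W.bracket f g) Z) : mlieBracket I X Y = Z := by
  have hW' := hW.toIsBivectorField
  have hXs := hW'.contMDiff_of_isHamiltonian hf hX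
  have hYs := hW'.contMDiff_of_isHamiltonian hg hY
  ext1 x
  refine eq_of_forall_mvfderiv_eq fun h hh => ?_
  rw [mvfderiv_mlieBracket hh ((hXs x).mdifferentiableAt (by simp))
    ((hYs x).mdifferentiableAt (by simp))]
  have h2 : (fun y => mvfderiv I h y (X y)) = W.bracket f h := funext fun y => hX y _
  have h3 : (fun y => mvfderiv I h y (Y y)) = W.bracket g h := funext fun y => hY y _
  rw [h2, h3, hX, hY, hZ]
  have h1 := congrFun (hW.jacobi f g h hf hg hh) x
  rw [hW'.bracket_swap (W.bracket g h) f, hW'.bracket_swap h f, bracket_neg_left,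
    hW'.bracket_swap (W.bracket f h) g, neg_neg] at h1
  have h4 : W.bracket (W.bracket f g) h x + -W.bracket f (W.bracket g h) x +
    W.bracket g (W.bracket f h) x = 0 := h1
  change W.bracket f (W.bracket g h) x - W.bracket g (W.bracket f h) x =
    W.bracket (W.bracket f g) h x
  linarith

end ContravariantTwoTensor

end Jacobiator
end

/-! ### Frames, 1-forms and covariant derivatives on the base -/

noncomputable section

section BaseManifold

open Set Filter Topology VectorField

set_option linter.unusedSectionVars false

variable {E : Type*} [NormedAddCommGroup E] [NormedSpace ℝ E] [FiniteDimensional ℝ E]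
  {M : Type*} [TopologicalSpace M] [ChartedSpace E M]

theorem ContravariantTwoTensor.isHamiltonian_hamiltonian (w : ContravariantTwoTensor 𝓘(ℝ, E) M)
    (f : M → ℝ) : w.IsHamiltonian f (w.hamiltonian f) :=
  fun x b => w.apply_sharp x _ b

theorem ContravariantTwoTensor.sharp_add (w : ContravariantTwoTensor 𝓘(ℝ, E) M) (x : M)
    (a b : CotangentSpace E x) : w.sharp x (a + b) = w.sharp x a + w.sharp x b := by
  simp [sharp, add_smul, Finset.sum_add_distrib]

theorem ContravariantTwoTensor.sharp_smul (w : ContravariantTwoTensor 𝓘(ℝ, E) M) (x : M)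
    (c : ℝ) (a : CotangentSpace E x) : w.sharp x (c • a) = c • w.sharp x a := by
  simp [sharp, mul_smul, Finset.smul_sum]

theorem ContravariantTwoTensor.sharp_neg (w : ContravariantTwoTensor 𝓘(ℝ, E) M) (x : M)
    (a : CotangentSpace E x) : w.sharp x (-a) = -w.sharp x a := by
  simp [sharp]

theorem ContravariantTwoTensor.sharp_sub (w : ContravariantTwoTensor 𝓘(ℝ, E) M) (x : M)
    (a b : CotangentSpace E x) : w.sharp x (a - b) = w.sharp x a - w.sharp x b := by
  simp [sharp, sub_smul, Finset.sum_sub_distrib]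

variable [IsManifold 𝓘(ℝ, E) ∞ M]

theorem contMDiffAt_coordVectorField (x₀ : M) (e : E) {x : M} (hx : x ∈ (chartAt E x₀).source) :
    ContMDiffAt 𝓘(ℝ, E) 𝓘(ℝ, E).tangent ∞ (T% (coordVectorField x₀ e)) x := by
  have hx' : x ∈ (trivializationAt E (TangentSpace 𝓘(ℝ, E) : M → Type _) x₀).baseSet := by
    simpa using hx
  rw [Trivialization.contMDiffAt_section_iff
    (e := trivializationAt E (TangentSpace 𝓘(ℝ, E) : M → Type _) x₀) hx']
  refine (contMDiffAt_const (c := e)).congr_of_eventuallyEq ?_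
  filter_upwards [(trivializationAt E (TangentSpace 𝓘(ℝ, E) : M → Type _) x₀).open_baseSet.mem_nhds
    hx'] with y hy
  have h := (trivializationAt E (TangentSpace 𝓘(ℝ, E) : M → Type _) x₀).continuousLinearMapAt_symmL
    (R := ℝ) hy e
  rwa [Trivialization.continuousLinearMapAt_apply, Trivialization.linearMapAt_apply, if_pos hy] at h

theorem coordVectorField_mfderiv_extChartAt (x₀ : M) {x : M} (hx : x ∈ (chartAt E x₀).source)
    (v : TangentSpace 𝓘(ℝ, E) x) :
    coordVectorField (E := E) x₀ (mfderiv 𝓘(ℝ, E) 𝓘(ℝ, E) (extChartAt 𝓘(ℝ, E) x₀) x v : E) x = v := by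
  have hx' : x ∈ (trivializationAt E (TangentSpace 𝓘(ℝ, E) : M → Type _) x₀).baseSet := by
    simpa using hx
  have h := (trivializationAt E (TangentSpace 𝓘(ℝ, E) : M → Type _) x₀).symmL_continuousLinearMapAt
    (R := ℝ) hx' v
  refine Eq.trans (congrArg (fun u : E => coordVectorField x₀ u x) ?_) h
  exact (DFunLike.congr_fun (TangentBundle.continuousLinearMapAt_trivializationAt hx) v).symm

theorem exists_contMDiff_eventuallyEq_coordVectorField [T2Space M] (x₀ : M) (e : E) :
    ∃ Z : ∀ x : M, TangentSpace 𝓘(ℝ, E) x, IsSmoothVectorField Z ∧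
      ∀ᶠ x in 𝓝 x₀, Z x = coordVectorField x₀ e x := by
  obtain ⟨χ⟩ : Nonempty (SmoothBumpFunction 𝓘(ℝ, E) x₀) := inferInstance
  refine ⟨fun x => χ x • coordVectorField x₀ e x, ?_, ?_⟩
  · refine ContMDiffOn.smul_section_of_tsupport (u := (chartAt E x₀).source)
      χ.contMDiff.contMDiffOn (chartAt E x₀).open_source χ.tsupport_subset_chartAt_source ?_
    exact fun x hx => (contMDiffAt_coordVectorField x₀ e hx).contMDiffWithinAt
  · filter_upwards [χ.eventuallyEq_one] with x hx
    simp [hx]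

/-- Smooth functions and vector fields that restrict to a coframe and its dual frame near `x₀`. -/
theorem exists_local_coframe [T2Space M] (x₀ : M) :
    ∃ (n : ℕ) (y : Fin n → M → ℝ) (Z : Fin n → ∀ x : M, TangentSpace 𝓘(ℝ, E) x),
      (∀ i, ContMDiff 𝓘(ℝ, E) 𝓘(ℝ, ℝ) ∞ (y i)) ∧ (∀ i, IsSmoothVectorField (Z i)) ∧
      ∀ᶠ x in 𝓝 x₀, ∀ v : TangentSpace 𝓘(ℝ, E) x, v = ∑ i, mvfderiv 𝓘(ℝ, E) (y i) x v • Z i x := by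
  let b := Module.finBasis ℝ E
  choose y hy hyl using fun i => exists_contMDiff_eventuallyEq_extChartAt (I := 𝓘(ℝ, E)) x₀
    (LinearMap.toContinuousLinearMap (b.coord i))
  choose Z hZ hZl using fun i => exists_contMDiff_eventuallyEq_coordVectorField x₀ (b i)
  refine ⟨_, y, Z, hy, hZ, ?_⟩
  filter_upwards [eventually_all.2 hZl, eventually_all.2 fun i => (hyl i).eventuallyEq_nhds,
    (chartAt E x₀).open_source.mem_nhds (mem_chart_source E x₀)] with x hZx hyx hx v
  set u : E := mfderiv 𝓘(ℝ, E) 𝓘(ℝ, E) (extChartAt 𝓘(ℝ, E) x₀) x v with hu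
  have h1 : ∀ i, mvfderiv 𝓘(ℝ, E) (y i) x v = b.coord i u := fun i => by
    rw [(hyx i).mvfderiv_eq, mvfderiv_clm_comp_extChartAt _ hx]
    rfl
  simp only [h1, hZx]
  have h2 : coordVectorField x₀ (∑ i, b.coord i u • b i) x =
      ∑ i, b.coord i u • coordVectorField x₀ (b i) x := by
    simp only [coordVectorField, map_sum, map_smul]
  rw [← h2, show ∑ i, b.coord i u • b i = u from b.sum_repr u]
  exact (coordVectorField_mfderiv_extChartAt x₀ hx v).symm

/-- In the trivialization of the cotangent bundle at `x₀`, the components of `α` are its values on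
the coordinate vector fields. -/
theorem contMDiffAt_oneForm_of_coordVectorField {α : ∀ x : M, CotangentSpace E x} {x₀ : M}
    (h : ∀ e : E, ContMDiffAt 𝓘(ℝ, E) 𝓘(ℝ, ℝ) ∞
      (fun x => (α x (coordVectorField x₀ e x) : ℝ)) x₀) :
    ContMDiffAt 𝓘(ℝ, E) (𝓘(ℝ, E).prod 𝓘(ℝ, E →L[ℝ] ℝ)) ∞
      (fun x => TotalSpace.mk' (E →L[ℝ] ℝ) x (α x) : M → CotangentBundle E M) x₀ := by
  rw [contMDiffAt_hom_bundle]
  refine ⟨contMDiffAt_id, ?_⟩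
  let b := Module.finBasis ℝ E
  have h2 : ContMDiffAt 𝓘(ℝ, E) 𝓘(ℝ, E →L[ℝ] ℝ) ∞ (fun x => ∑ i,
      (α x (coordVectorField x₀ (b i) x) : ℝ) • LinearMap.toContinuousLinearMap (b.coord i)) x₀ :=
    contMDiffAt_finsetSum fun i _ => (h (b i)).smul contMDiffAt_const
  refine h2.congr_of_eventuallyEq (Eventually.of_forall fun x => ?_)
  refine ContinuousLinearMap.coe_injective (b.ext fun j => ?_)
  simp [ContinuousLinearMap.inCoordinates, coordVectorField, Finsupp.single_apply]

theorem isSmoothOneForm_mvfderiv {f : M → ℝ} (hf : ContMDiff 𝓘(ℝ, E) 𝓘(ℝ, ℝ) ∞ f) :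
    IsSmoothOneForm (fun x => (mvfderiv 𝓘(ℝ, E) f x : CotangentSpace E x)) := fun x₀ =>
  contMDiffAt_oneForm_of_coordVectorField fun e =>
    hf.contMDiffAt_mvfderiv_apply (contMDiffAt_coordVectorField x₀ e (mem_chart_source E x₀))

theorem ContravariantTwoTensor.IsBivectorField.isSmoothVectorField_hamiltonian [T2Space M]
    {w : ContravariantTwoTensor 𝓘(ℝ, E) M} (hw : w.IsBivectorField) {f : M → ℝ}
    (hf : ContMDiff 𝓘(ℝ, E) 𝓘(ℝ, ℝ) ∞ f) : IsSmoothVectorField (w.hamiltonian f) :=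
  hw.contMDiff_of_isHamiltonian hf (w.isHamiltonian_hamiltonian f)

theorem IsSmoothVectorField.mdifferentiableAt {Z : ∀ x : M, TangentSpace 𝓘(ℝ, E) x}
    (hZ : IsSmoothVectorField Z) (x : M) : MDiffAt (T% Z) x :=
  (hZ x).mdifferentiableAt (by simp)

/-- Differentiability of a 1-form at a point. -/
abbrev OneFormDifferentiableAt (α : ∀ x : M, CotangentSpace E x) (x : M) : Prop :=
  MDifferentiableAt 𝓘(ℝ, E) (𝓘(ℝ, E).prod 𝓘(ℝ, E →L[ℝ] ℝ))
    (fun y => TotalSpace.mk' (E →L[ℝ] ℝ) y (α y) : M → CotangentBundle E M) x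

theorem IsSmoothOneForm.mdifferentiableAt {α : ∀ x : M, CotangentSpace E x}
    (hα : IsSmoothOneForm α) (x : M) : OneFormDifferentiableAt α x :=
  (hα x).mdifferentiableAt (by simp)

theorem mdifferentiableAt_oneForm_apply {α : ∀ x : M, CotangentSpace E x}
    {Z : ∀ x : M, TangentSpace 𝓘(ℝ, E) x} {x : M} (hα : OneFormDifferentiableAt α x) (hZ : MDiffAt (T% Z) x) :
    MDifferentiableAt 𝓘(ℝ, E) 𝓘(ℝ, ℝ) (fun y => (α y (Z y) : ℝ)) x := by
  have h := (mdifferentiableAt_totalSpace _ _).1 (hα.clm_bundle_apply hZ)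
  simpa using h.2

/-- Skew-symmetry gives `dg(♯α) = -α(X_g)`. The components of `♯α` are therefore pairings of `α`
with smooth Hamiltonian fields. -/
theorem ContravariantTwoTensor.IsBivectorField.mdifferentiableAt_sharp [T2Space M]
    {w : ContravariantTwoTensor 𝓘(ℝ, E) M} (hw : w.IsBivectorField)
    {α : ∀ x : M, CotangentSpace E x} {x : M} (hα : OneFormDifferentiableAt α x) :
    MDiffAt (T% (fun y => w.sharp y (α y))) x := by
  refine mdifferentiableAt_vectorField_of_coordinates fun l => ?_
  obtain ⟨g, hg, hgl⟩ := exists_contMDiff_eventuallyEq_extChartAt (I := 𝓘(ℝ, E)) x l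
  refine ⟨g, hgl, ?_⟩
  have h1 := mdifferentiableAt_oneForm_apply hα
    ((hw.isSmoothVectorField_hamiltonian hg).mdifferentiableAt x)
  refine h1.neg.congr_of_eventuallyEq (Eventually.of_forall fun y => ?_)
  change mvfderiv 𝓘(ℝ, E) g y (w.sharp y (α y)) = -α y (w.hamiltonian g y)
  rw [w.isHamiltonian_hamiltonian g y (α y), ← hw.skew]
  exact w.apply_sharp y _ _

namespace LinearConnection

variable {nabla : LinearConnection E M}

theorem contMDiff_covariantDerivative (hnabla : nabla.ContMDiffCovariantDerivative ∞)
    {Z : ∀ x : M, TangentSpace 𝓘(ℝ, E) x} (hZ : IsSmoothVectorField Z) :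
    ContMDiff 𝓘(ℝ, E) (𝓘(ℝ, E).prod 𝓘(ℝ, E →L[ℝ] E)) ∞
      (fun x => (⟨x, nabla Z x⟩ : TotalSpace (E →L[ℝ] E)
        fun x : M => TangentSpace 𝓘(ℝ, E) x →L[ℝ] TangentSpace 𝓘(ℝ, E) x)) := by
  rw [← contMDiffOn_univ]
  exact hnabla.contMDiff.contMDiff (σ := Z) (ContMDiff.contMDiffOn hZ)

theorem isSmoothVectorField_deriv (hnabla : nabla.ContMDiffCovariantDerivative ∞)
    {X Z : ∀ x : M, TangentSpace 𝓘(ℝ, E) x} (hX : IsSmoothVectorField X)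
    (hZ : IsSmoothVectorField Z) : IsSmoothVectorField (nabla.deriv X Z) :=
  (contMDiff_covariantDerivative hnabla hZ).clm_bundle_apply hX

theorem mdifferentiableAt_deriv (hnabla : nabla.ContMDiffCovariantDerivative ∞)
    {X Z : ∀ x : M, TangentSpace 𝓘(ℝ, E) x} {x : M} (hX : MDiffAt (T% X) x)
    (hZ : IsSmoothVectorField Z) : MDiffAt (T% (nabla.deriv X Z)) x :=
  ((contMDiff_covariantDerivative hnabla hZ x).mdifferentiableAt (by simp)).clm_bundle_apply hX

end LinearConnection

end BaseManifold
end

/-! ### Curvature of the contravariant connection -/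

noncomputable section

section ContravariantCurvature

open Set Filter Topology VectorField

set_option linter.unusedSectionVars false

variable {E : Type*} [NormedAddCommGroup E] [NormedSpace ℝ E] [FiniteDimensional ℝ E]
  {M : Type*} [TopologicalSpace M] [ChartedSpace E M] [IsManifold 𝓘(ℝ, E) ∞ M]

/-- `TensorialAt` for the curvature involves 1-forms that are only differentiable at `x`, so the
tensoriality of the Lie derivative is needed under this weaker assumption. -/
theorem OneFormDifferentiableAt.lieDerivOneForm_tensorialAt
    (X : ∀ x : M, TangentSpace 𝓘(ℝ, E) x) {β : ∀ x : M, CotangentSpace E x} {x : M}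
    (hβ : OneFormDifferentiableAt β x) : TensorialAt 𝓘(ℝ, E) E (lieDerivOneForm X β x) x := by
  have : CompleteSpace E := FiniteDimensional.complete ℝ E
  constructor
  · intro f σ hf hσ
    have h1 : (fun y => (β y ((f • σ) y) : ℝ)) = f * fun y => (β y (σ y) : ℝ) := by
      ext y; simp
    simp only [lieDerivOneForm]
    rw [h1, mvfderiv_mul hf (mdifferentiableAt_oneForm_apply hβ hσ), mlieBracket_smul_right hf hσ]
    simp only [map_add, map_smul, add_apply, smul_apply, smul_eq_mul]
    ring
  · intro σ σ' hσ hσ'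
    have h1 : (fun y => (β y ((σ + σ') y) : ℝ)) =
        (fun y => (β y (σ y) : ℝ)) + fun y => (β y (σ' y) : ℝ) := by
      ext y; simp
    simp only [lieDerivOneForm]
    rw [h1, mvfderiv_add (mdifferentiableAt_oneForm_apply hβ hσ)
      (mdifferentiableAt_oneForm_apply hβ hσ'), mlieBracket_add_right hσ hσ']
    simp only [map_add, add_apply]
    ring

theorem OneFormDifferentiableAt.oneFormBracket_apply (w : ContravariantTwoTensor 𝓘(ℝ, E) M)
    {α β : ∀ x : M, CotangentSpace E x} {x : M} (hα : OneFormDifferentiableAt α x)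
    (hβ : OneFormDifferentiableAt β x) {Z : ∀ x : M, TangentSpace 𝓘(ℝ, E) x}
    (hZ : MDiffAt (T% Z) x) :
    oneFormBracket w α β x (Z x) = oneFormBracketAux w α β x Z := by
  have h1 := hβ.lieDerivOneForm_tensorialAt (fun y => w.sharp y (α y))
  have h2 := hα.lieDerivOneForm_tensorialAt (fun y => w.sharp y (β y))
  have h : TensorialAt 𝓘(ℝ, E) E (oneFormBracketAux w α β x) x := by
    constructor
    · intro f σ hf hσ
      simp only [oneFormBracketAux, h1.smul hf hσ, h2.smul hf hσ, Pi.smul_apply', map_smul]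
      simp only [smul_eq_mul]; ring
    · intro σ σ' hσ hσ'
      simp only [oneFormBracketAux, h1.add hσ hσ', h2.add hσ hσ', Pi.add_apply, map_add]
      ring
  rw [oneFormBracket, dif_pos h]
  exact h.mkHom_apply hZ

theorem cotangent_ext {x : M} {a b : CotangentSpace E x}
    (h : ∀ Z : ∀ x : M, TangentSpace 𝓘(ℝ, E) x, MDiffAt (T% Z) x → a (Z x) = b (Z x)) : a = b := by
  refine ContinuousLinearMap.ext fun v => ?_
  have := h (FiberBundle.extend E v) (FiberBundle.mdifferentiableAt_extend ..)
  simpa using this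

variable {w : ContravariantTwoTensor 𝓘(ℝ, E) M}

theorem ContravariantTwoTensor.IsBivectorField.oneFormBracket_swap (hw : w.IsBivectorField)
    {α β : ∀ x : M, CotangentSpace E x} {x : M} (hα : OneFormDifferentiableAt α x)
    (hβ : OneFormDifferentiableAt β x) :
    oneFormBracket w β α x = -oneFormBracket w α β x := by
  refine cotangent_ext fun Z hZ => ?_
  rw [hβ.oneFormBracket_apply w hα hZ, neg_apply, hα.oneFormBracket_apply w hβ hZ]
  have h : (fun y => w y (β y) (α y)) = -fun y => w y (α y) (β y) :=
    funext fun y => hw.skew y _ _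
  simp only [oneFormBracketAux, h, mvfderiv_neg, neg_apply]
  ring

/-- The commutator formula gives `L_{X_f} dg = d{f, g}` and `L_{X_g} df = -d{f, g}`, and subtracting
`d(w(df, dg))` leaves one copy. The Jacobi identity plays no role here. -/
theorem oneFormBracket_mvfderiv (hw : w.IsBivectorField) [T2Space M] {f g : M → ℝ}
    (hf : ContMDiff 𝓘(ℝ, E) 𝓘(ℝ, ℝ) ∞ f) (hg : ContMDiff 𝓘(ℝ, E) 𝓘(ℝ, ℝ) ∞ g) (x : M) :
    oneFormBracket w (mvfderiv 𝓘(ℝ, E) f) (mvfderiv 𝓘(ℝ, E) g) x =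
      mvfderiv 𝓘(ℝ, E) (w.bracket f g) x := by
  refine cotangent_ext fun Z hZ => ?_
  rw [((isSmoothOneForm_mvfderiv hf).mdifferentiableAt x).oneFormBracket_apply w
    ((isSmoothOneForm_mvfderiv hg).mdifferentiableAt x) hZ]
  have hXf := (hw.isSmoothVectorField_hamiltonian hf).mdifferentiableAt x
  have hXg := (hw.isSmoothVectorField_hamiltonian hg).mdifferentiableAt x
  have h1 := mvfderiv_mlieBracket hg hXf hZ
  have h2 := mvfderiv_mlieBracket hf hXg hZ
  have h3 : (fun y => mvfderiv 𝓘(ℝ, E) g y (w.hamiltonian f y)) = w.bracket f g :=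
    funext fun y => w.apply_sharp y _ _
  have h4 : (fun y => mvfderiv 𝓘(ℝ, E) f y (w.hamiltonian g y)) = -w.bracket f g := by
    rw [← hw.bracket_swap]
    exact funext fun y => w.apply_sharp y _ _
  rw [h3] at h1
  rw [h4, mvfderiv_neg, neg_apply] at h2
  change mvfderiv 𝓘(ℝ, E) (fun y => mvfderiv 𝓘(ℝ, E) g y (Z y)) x (w.hamiltonian f x)
      - mvfderiv 𝓘(ℝ, E) g x (mlieBracket 𝓘(ℝ, E) (w.hamiltonian f) Z x)
      - (mvfderiv 𝓘(ℝ, E) (fun y => mvfderiv 𝓘(ℝ, E) f y (Z y)) x (w.hamiltonian g x)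
      - mvfderiv 𝓘(ℝ, E) f x (mlieBracket 𝓘(ℝ, E) (w.hamiltonian g) Z x))
      - mvfderiv 𝓘(ℝ, E) (w.bracket f g) x (Z x) = mvfderiv 𝓘(ℝ, E) (w.bracket f g) x (Z x)
  rw [h1, h2]
  ring

theorem oneFormBracket_smul_left (hw : w.IsBivectorField) [T2Space M] {f : M → ℝ} {x : M}
    (hf : MDifferentiableAt 𝓘(ℝ, E) 𝓘(ℝ, ℝ) f x) {α β : ∀ x : M, CotangentSpace E x}
    (hα : OneFormDifferentiableAt α x) (hβ : OneFormDifferentiableAt β x) :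
    oneFormBracket w (f • α) β x = f x • oneFormBracket w α β x -
      (mvfderiv 𝓘(ℝ, E) f x (w.sharp x (β x)) : ℝ) • α x := by
  have : CompleteSpace E := FiniteDimensional.complete ℝ E
  refine cotangent_ext fun Z hZ => ?_
  have hfα : OneFormDifferentiableAt (f • α) x := hf.smul_section hα
  rw [hfα.oneFormBracket_apply w hβ hZ, sub_apply, smul_apply, smul_apply,
    hα.oneFormBracket_apply w hβ hZ]
  have hα' := hw.mdifferentiableAt_sharp hα
  have h1 : (fun y => w.sharp y ((f • α) y)) = f • fun y => w.sharp y (α y) :=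
    funext fun y => w.sharp_smul y _ _
  have h2 : (fun y => w y ((f • α) y) (β y)) = f * fun y => w y (α y) (β y) := by
    funext y; simp
  have h3 : (fun y => ((f • α) y (Z y) : ℝ)) = f * fun y => (α y (Z y) : ℝ) := by
    funext y; simp
  have h4 : MDifferentiableAt 𝓘(ℝ, E) 𝓘(ℝ, ℝ) (fun y => w y (α y) (β y)) x :=
    (mdifferentiableAt_oneForm_apply hβ hα').congr_of_eventuallyEq
      (Eventually.of_forall fun y => (w.apply_sharp y _ _).symm)
  simp only [oneFormBracketAux, lieDerivOneForm, h1, h2, h3]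
  rw [mvfderiv_mul hf h4, mvfderiv_mul hf (mdifferentiableAt_oneForm_apply hα hZ),
    mlieBracket_smul_left hf hα']
  simp only [map_add, map_smul, add_apply, smul_apply, smul_eq_mul, Pi.smul_apply', neg_smul,
    map_neg, w.apply_sharp, LinearMap.smul_apply]
  ring

theorem oneFormBracket_add_left (hw : w.IsBivectorField) [T2Space M] {x : M}
    {α α' β : ∀ x : M, CotangentSpace E x} (hα : OneFormDifferentiableAt α x)
    (hα' : OneFormDifferentiableAt α' x) (hβ : OneFormDifferentiableAt β x) :
    oneFormBracket w (α + α') β x = oneFormBracket w α β x + oneFormBracket w α' β x := by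
  have : CompleteSpace E := FiniteDimensional.complete ℝ E
  refine cotangent_ext fun Z hZ => ?_
  have hαα' : OneFormDifferentiableAt (α + α') x := mdifferentiableAt_add_section hα hα'
  rw [hαα'.oneFormBracket_apply w hβ hZ, add_apply, hα.oneFormBracket_apply w hβ hZ,
    hα'.oneFormBracket_apply w hβ hZ]
  have hs := hw.mdifferentiableAt_sharp hα
  have hs' := hw.mdifferentiableAt_sharp hα'
  have h1 : (fun y => w.sharp y ((α + α') y)) =
      (fun y => w.sharp y (α y)) + fun y => w.sharp y (α' y) :=
    funext fun y => w.sharp_add y _ _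
  have h2 : (fun y => w y ((α + α') y) (β y)) =
      (fun y => w y (α y) (β y)) + fun y => w y (α' y) (β y) := by
    funext y; simp
  have h3 : (fun y => ((α + α') y (Z y) : ℝ)) =
      (fun y => (α y (Z y) : ℝ)) + fun y => (α' y (Z y) : ℝ) := by
    funext y; simp
  have h4 : ∀ {γ : ∀ x : M, CotangentSpace E x}, MDiffAt (T% fun y => w.sharp y (γ y)) x →
      MDifferentiableAt 𝓘(ℝ, E) 𝓘(ℝ, ℝ) (fun y => w y (γ y) (β y)) x := fun hγ =>
    (mdifferentiableAt_oneForm_apply hβ hγ).congr_of_eventuallyEq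
      (Eventually.of_forall fun y => (w.apply_sharp y _ _).symm)
  simp only [oneFormBracketAux, lieDerivOneForm, h1, h2, h3]
  rw [mvfderiv_add (h4 hs) (h4 hs'), mvfderiv_add (mdifferentiableAt_oneForm_apply hα hZ)
    (mdifferentiableAt_oneForm_apply hα' hZ), mlieBracket_add_left hs hs']
  simp only [map_add, add_apply, Pi.add_apply, w.sharp_add]
  ring

variable {nabla : LinearConnection E M}

theorem contravariantCurvature_tensorialAt (hw : w.IsBivectorField) [T2Space M]
    (hnabla : nabla.ContMDiffCovariantDerivative ∞) {β : ∀ x : M, CotangentSpace E x}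
    {Z : ∀ x : M, TangentSpace 𝓘(ℝ, E) x} {x : M} (hβ : OneFormDifferentiableAt β x)
    (hZ : IsSmoothVectorField Z) :
    TensorialAt (V := (CotangentSpace E : M → Type _)) 𝓘(ℝ, E) (E →L[ℝ] ℝ)
      (fun α => contravariantCurvature w (nabla.contravariant w) α β Z x) x := by
  have hD : ∀ {α : ∀ x : M, CotangentSpace E x}, OneFormDifferentiableAt α x →
      MDiffAt (T% (nabla.contravariant w α Z)) x := fun hα =>
    LinearConnection.mdifferentiableAt_deriv hnabla (hw.mdifferentiableAt_sharp hα) hZ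
  constructor
  · intro f α hf hα
    have h1 : nabla.contravariant w (f • α) Z = f • nabla.contravariant w α Z := by
      funext y
      change nabla Z y (w.sharp y (f y • α y)) = f y • nabla Z y (w.sharp y (α y))
      rw [w.sharp_smul, map_smul]
    change nabla (nabla.contravariant w β Z) x (w.sharp x (f x • α x))
      - nabla (nabla.contravariant w (f • α) Z) x (w.sharp x (β x))
      - nabla Z x (w.sharp x (oneFormBracket w (f • α) β x)) = f x •
      (nabla (nabla.contravariant w β Z) x (w.sharp x (α x))
      - nabla (nabla.contravariant w α Z) x (w.sharp x (β x))
      - nabla Z x (w.sharp x (oneFormBracket w α β x)))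
    -- The term with `df(♯β)` from the Leibniz rule for `∇_{♯β}(f D_α Z)` cancels the one coming
    -- from the bracket `[fα, β]`.
    rw [h1, nabla.isCovariantDerivativeOnUniv.leibniz (hD hα) hf,
      oneFormBracket_smul_left hw hf hα hβ, w.sharp_sub, w.sharp_smul, w.sharp_smul, w.sharp_smul]
    have h2 : nabla.contravariant w α Z x = nabla Z x (w.sharp x (α x)) := rfl
    simp only [map_sub, map_smul, add_apply, smul_apply, ContinuousLinearMap.smulRight_apply, h2]
    module
  · intro α α' hα hα'
    have h1 : nabla.contravariant w (α + α') Z =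
        nabla.contravariant w α Z + nabla.contravariant w α' Z := by
      funext y
      change nabla Z y (w.sharp y (α y + α' y)) = _
      rw [w.sharp_add, map_add]
      rfl
    change nabla (nabla.contravariant w β Z) x (w.sharp x (α x + α' x))
      - nabla (nabla.contravariant w (α + α') Z) x (w.sharp x (β x))
      - nabla Z x (w.sharp x (oneFormBracket w (α + α') β x)) =
      (nabla (nabla.contravariant w β Z) x (w.sharp x (α x))
      - nabla (nabla.contravariant w α Z) x (w.sharp x (β x))
      - nabla Z x (w.sharp x (oneFormBracket w α β x))) +
      (nabla (nabla.contravariant w β Z) x (w.sharp x (α' x))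
      - nabla (nabla.contravariant w α' Z) x (w.sharp x (β x))
      - nabla Z x (w.sharp x (oneFormBracket w α' β x)))
    rw [h1, nabla.isCovariantDerivativeOnUniv.add (hD hα) (hD hα'),
      oneFormBracket_add_left hw hα hα' hβ, w.sharp_add, w.sharp_add]
    simp only [map_add, add_apply]
    module

theorem contravariantCurvature_swap (hw : w.IsBivectorField)
    {α β : ∀ x : M, CotangentSpace E x} {x : M} (hα : OneFormDifferentiableAt α x)
    (hβ : OneFormDifferentiableAt β x) (Z : ∀ x : M, TangentSpace 𝓘(ℝ, E) x) :
    contravariantCurvature w (nabla.contravariant w) α β Z x =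
      -contravariantCurvature w (nabla.contravariant w) β α Z x := by
  change nabla (nabla.contravariant w β Z) x (w.sharp x (α x))
      - nabla (nabla.contravariant w α Z) x (w.sharp x (β x))
      - nabla Z x (w.sharp x (oneFormBracket w α β x)) =
      -(nabla (nabla.contravariant w α Z) x (w.sharp x (β x))
      - nabla (nabla.contravariant w β Z) x (w.sharp x (α x))
      - nabla Z x (w.sharp x (oneFormBracket w β α x)))
  rw [hw.oneFormBracket_swap hα hβ, w.sharp_neg, map_neg]
  module

/-- Here the Jacobi identity enters, through `[X_f, X_g] = X_{{f, g}} = ♯[df, dg]`. -/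
theorem contravariantCurvature_mvfderiv (hw : w.IsPoisson) [T2Space M] {f g : M → ℝ}
    (hf : ContMDiff 𝓘(ℝ, E) 𝓘(ℝ, ℝ) ∞ f) (hg : ContMDiff 𝓘(ℝ, E) 𝓘(ℝ, ℝ) ∞ g)
    (Z : ∀ x : M, TangentSpace 𝓘(ℝ, E) x) :
    contravariantCurvature w (nabla.contravariant w) (mvfderiv 𝓘(ℝ, E) f) (mvfderiv 𝓘(ℝ, E) g) Z =
      nabla.curvature (w.hamiltonian f) (w.hamiltonian g) Z := by
  have h1 : mlieBracket 𝓘(ℝ, E) (w.hamiltonian f) (w.hamiltonian g) =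
      fun x => w.sharp x (oneFormBracket w (mvfderiv 𝓘(ℝ, E) f) (mvfderiv 𝓘(ℝ, E) g) x) := by
    rw [hw.isHamiltonian_mlieBracket hf hg (w.isHamiltonian_hamiltonian f)
      (w.isHamiltonian_hamiltonian g) (w.isHamiltonian_hamiltonian _)]
    funext x
    rw [oneFormBracket_mvfderiv hw.toIsBivectorField hf hg]
    rfl
  rw [LinearConnection.curvature, h1]
  rfl

/-- The curvature of the contravariant connection induced by `∇` vanishes if and only if
`R_∇(X_f, X_g) = 0` for all functions `f`, `g`. -/
theorem contravariantCurvature_eq_zero_iff (hw : w.IsPoisson) [T2Space M]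
    (hnabla : nabla.ContMDiffCovariantDerivative ∞) {Z : ∀ x : M, TangentSpace 𝓘(ℝ, E) x}
    (hZ : IsSmoothVectorField Z) :
    (∀ α β : ∀ x : M, CotangentSpace E x, IsSmoothOneForm α → IsSmoothOneForm β →
      contravariantCurvature w (nabla.contravariant w) α β Z = 0) ↔
    ∀ f g : M → ℝ, ContMDiff 𝓘(ℝ, E) 𝓘(ℝ, ℝ) ∞ f → ContMDiff 𝓘(ℝ, E) 𝓘(ℝ, ℝ) ∞ g →
      nabla.curvature (w.hamiltonian f) (w.hamiltonian g) Z = 0 := by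
  have hw' := hw.toIsBivectorField
  constructor
  · intro h f g hf hg
    rw [← contravariantCurvature_mvfderiv hw hf hg]
    exact h _ _ (isSmoothOneForm_mvfderiv hf) (isSmoothOneForm_mvfderiv hg)
  · intro h α β hα hβ
    funext x
    obtain ⟨f, hf, hfα⟩ := exists_mvfderiv_eq (I := 𝓘(ℝ, E)) x (α x)
    obtain ⟨g, hg, hgβ⟩ := exists_mvfderiv_eq (I := 𝓘(ℝ, E)) x (β x)
    have hα' := hα.mdifferentiableAt x
    have hβ' := hβ.mdifferentiableAt x
    have hf' := (isSmoothOneForm_mvfderiv hf).mdifferentiableAt x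
    have hg' := (isSmoothOneForm_mvfderiv hg).mdifferentiableAt x
    -- Tensoriality replaces `α` by `df`; skew-symmetry then moves `β` to the first slot, where it
    -- is replaced by `dg`.
    have h1 := (contravariantCurvature_tensorialAt hw' hnabla hβ' hZ).pointwise hα' hf' hfα.symm
    have h2 := (contravariantCurvature_tensorialAt hw' hnabla hf' hZ).pointwise hβ' hg' hgβ.symm
    refine h1.trans ?_
    rw [contravariantCurvature_swap hw' hf' hβ', h2, ← contravariantCurvature_swap hw' hf' hg',
      contravariantCurvature_mvfderiv hw hf hg, h f g hf hg]

end ContravariantCurvature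
end

/-! ### The cotangent bundle: pullbacks and momenta -/

noncomputable section

section CotangentManifold

open Set Filter Topology VectorField

set_option linter.unusedSectionVars false

variable {E : Type*} [NormedAddCommGroup E] [NormedSpace ℝ E] [FiniteDimensional ℝ E]
  {M : Type*} [TopologicalSpace M] [ChartedSpace E M] [IsManifold 𝓘(ℝ, E) ∞ M]

/-- Points over distinct base points are separated by the projection, points of one fibre by a
trivialization. It makes the bump-function arguments available on the cotangent bundle. -/
theorem Bundle.TotalSpace.t2Space_of_fiberBundle {B F : Type*} [TopologicalSpace B] [T2Space B]
    [TopologicalSpace F] [T2Space F] (V : B → Type*) [TopologicalSpace (TotalSpace F V)]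
    [∀ b, TopologicalSpace (V b)] [FiberBundle F V] : T2Space (TotalSpace F V) := by
  refine ⟨fun u v huv => ?_⟩
  by_cases h : u.1 = v.1
  · let e := trivializationAt F V u.1
    have hu : u ∈ e.source := by
      rw [e.mem_source]; exact FiberBundle.mem_baseSet_trivializationAt' u.1
    have hv : v ∈ e.source := by
      rw [e.mem_source, ← show u.proj = v.proj from h]
      exact FiberBundle.mem_baseSet_trivializationAt' u.1
    have hne : e u ≠ e v := fun h' => huv (e.injOn hu hv h')
    obtain ⟨U, V', hU, hV, huU, hvV, hd⟩ := t2_separation hne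
    refine ⟨e.source ∩ e ⁻¹' U, e.source ∩ e ⁻¹' V', e.isOpen_inter_preimage hU,
      e.isOpen_inter_preimage hV, ⟨hu, huU⟩, ⟨hv, hvV⟩, ?_⟩
    exact (hd.preimage e).mono inter_subset_right inter_subset_right
  · obtain ⟨U, V', hU, hV, huU, hvV, hd⟩ := t2_separation h
    have hc := FiberBundle.continuous_proj F V
    exact ⟨_, _, hU.preimage hc, hV.preimage hc, huU, hvV, hd.preimage _⟩

instance cotangentBundle_t2Space [T2Space M] : T2Space (CotangentBundle E M) :=
  Bundle.TotalSpace.t2Space_of_fiberBundle (CotangentSpace E : M → Type _)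

/-- The natural coordinates are themselves a pullback from the base and momenta of coordinate
fields, which is why these two families of functions suffice. -/
theorem extChartAt_cotangentBundle (u z : CotangentBundle E M) :
    ((extChartAt (cotangentModel E) u z).1 = extChartAt 𝓘(ℝ, E) u.1 z.1) ∧
    ∀ e : E, (extChartAt (cotangentModel E) u z).2 e = momentum (coordVectorField u.1 e) z := by
  have h : extChartAt (cotangentModel E) u z = (extChartAt 𝓘(ℝ, E) u.1 z.1,
      ContinuousLinearMap.inCoordinates E (TangentSpace 𝓘(ℝ, E) : M → Type _) ℝ
        (Bundle.Trivial M ℝ) u.1 z.1 u.1 z.1 z.2) :=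
    hom_chart (𝕜 := ℝ) (F₁ := E) (E₁ := (TangentSpace 𝓘(ℝ, E) : M → Type _)) (F₂ := ℝ)
      (E₂ := Bundle.Trivial M ℝ) u z
  rw [h]
  refine ⟨rfl, fun e => ?_⟩
  simp [ContinuousLinearMap.inCoordinates, momentum, coordVectorField]

theorem mfderiv_cotangentBundle_proj (u : CotangentBundle E M) (ξ : E × (E →L[ℝ] ℝ)) :
    mfderiv (cotangentModel E) 𝓘(ℝ, E) (fun z : CotangentBundle E M => z.1) u ξ = (ξ.1 : E) := by
  have hπ : MDifferentiableAt (cotangentModel E) 𝓘(ℝ, E) (fun z : CotangentBundle E M => z.1) u :=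
    (contMDiff_proj (n := ∞) (IB := 𝓘(ℝ, E)) (CotangentSpace E : M → Type _) u).mdifferentiableAt
      (by simp)
  have h1 : (extChartAt 𝓘(ℝ, E) u.1) ∘ (fun z : CotangentBundle E M => z.1) =
      Prod.fst ∘ extChartAt (cotangentModel E) u :=
    funext fun z => (extChartAt_cotangentBundle u z).1.symm
  have h2 := mfderiv_comp_apply (I := cotangentModel E) (I' := 𝓘(ℝ, E)) (I'' := 𝓘(ℝ, E)) u
    (mdifferentiableAt_extChartAt (mem_chart_source E u.1)) hπ ξ
  have h3 := mfderiv_comp_apply (I := cotangentModel E) (I' := 𝓘(ℝ, E × (E →L[ℝ] ℝ)))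
    (I'' := 𝓘(ℝ, E)) (g := Prod.fst) u
    (ContinuousLinearMap.fst ℝ E (E →L[ℝ] ℝ)).differentiableAt.mdifferentiableAt
    (mdifferentiableAt_extChartAt (mem_chart_source _ u)) ξ
  rw [h1] at h2
  rw [mfderiv_extChartAt_self] at h2 h3
  rw [mfderiv_eq_fderiv] at h3
  refine (h2.symm.trans h3).trans ?_
  exact DFunLike.congr_fun (ContinuousLinearMap.fst ℝ E (E →L[ℝ] ℝ)).fderiv ξ

theorem mvfderiv_comp_proj {f : M → ℝ} {u : CotangentBundle E M}
    (hf : MDifferentiableAt 𝓘(ℝ, E) 𝓘(ℝ, ℝ) f u.1) (ξ : TangentSpace (cotangentModel E) u) :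
    mvfderiv (cotangentModel E) (fun z : CotangentBundle E M => f z.1) u ξ =
      mvfderiv 𝓘(ℝ, E) f u.1 (ξ.1 : E) := by
  have hπ : MDifferentiableAt (cotangentModel E) 𝓘(ℝ, E) (fun z : CotangentBundle E M => z.1) u :=
    (contMDiff_proj (n := ∞) (IB := 𝓘(ℝ, E)) (CotangentSpace E : M → Type _) u).mdifferentiableAt
      (by simp)
  refine (mvfderiv_comp_apply u hf hπ ξ).trans ?_
  exact congrArg (mvfderiv 𝓘(ℝ, E) f u.1) (mfderiv_cotangentBundle_proj u ξ)

theorem contMDiff_comp_proj {f : M → ℝ} (hf : ContMDiff 𝓘(ℝ, E) 𝓘(ℝ, ℝ) ∞ f) :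
    ContMDiff (cotangentModel E) 𝓘(ℝ, ℝ) ∞ (fun z : CotangentBundle E M => f z.1) :=
  hf.comp (contMDiff_proj (CotangentSpace E : M → Type _))

theorem mdifferentiableAt_momentum {Z : ∀ x : M, TangentSpace 𝓘(ℝ, E) x} {u : CotangentBundle E M}
    (hZ : MDiffAt (T% Z) u.1) :
    MDifferentiableAt (cotangentModel E) 𝓘(ℝ, ℝ) (momentum Z) u := by
  have hπ : MDifferentiableAt (cotangentModel E) 𝓘(ℝ, E) (fun z : CotangentBundle E M => z.1) u :=
    (contMDiff_proj (n := ∞) (IB := 𝓘(ℝ, E)) (CotangentSpace E : M → Type _) u).mdifferentiableAt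
      (by simp)
  have h1 : MDifferentiableAt (cotangentModel E) (𝓘(ℝ, E).prod 𝓘(ℝ, E →L[ℝ] ℝ))
      (fun z : CotangentBundle E M => TotalSpace.mk' (E →L[ℝ] ℝ)
        (E := fun x : M => TangentSpace 𝓘(ℝ, E) x →L[ℝ] Bundle.Trivial M ℝ x) z.1 z.2) u :=
    mdifferentiableAt_id
  have h2 : MDifferentiableAt (cotangentModel E) 𝓘(ℝ, E).tangent
      (fun z : CotangentBundle E M => TotalSpace.mk' E z.1 (Z z.1)) u :=
    MDifferentiableAt.comp (g := T% Z) u hZ hπ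
  have h := (mdifferentiableAt_totalSpace _ _).1 (h1.clm_bundle_apply h2)
  change MDifferentiableAt _ _ (fun z : CotangentBundle E M => z.2 (Z z.1)) u
  simpa using h.2

theorem contMDiff_momentum {Z : ∀ x : M, TangentSpace 𝓘(ℝ, E) x} (hZ : IsSmoothVectorField Z) :
    ContMDiff (cotangentModel E) 𝓘(ℝ, ℝ) ∞ (momentum Z) := by
  intro u
  have hπ := contMDiff_proj (n := ∞) (IB := 𝓘(ℝ, E)) (CotangentSpace E : M → Type _) u
  have h1 : ContMDiffAt (cotangentModel E) (𝓘(ℝ, E).prod 𝓘(ℝ, E →L[ℝ] ℝ)) ∞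
      (fun z : CotangentBundle E M => TotalSpace.mk' (E →L[ℝ] ℝ)
        (E := fun x : M => TangentSpace 𝓘(ℝ, E) x →L[ℝ] Bundle.Trivial M ℝ x) z.1 z.2) u :=
    contMDiffAt_id
  have h2 : ContMDiffAt (cotangentModel E) 𝓘(ℝ, E).tangent ∞
      (fun z : CotangentBundle E M => TotalSpace.mk' E z.1 (Z z.1)) u :=
    ContMDiffAt.comp (g := T% Z) u (hZ u.1) hπ
  have h := contMDiffAt_totalSpace.1 (h1.clm_bundle_apply h2)
  change ContMDiffAt _ _ _ (fun z : CotangentBundle E M => z.2 (Z z.1)) u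
  simpa using h.2

theorem coordVectorField_self (x : M) (e : E) : coordVectorField x e x = e := by
  have h := TangentBundle.symmL_trivializationAt (I := 𝓘(ℝ, E)) (mem_chart_source E x)
  rw [mfderivWithin_range_extChartAt_symm] at h
  exact DFunLike.congr_fun h e

/-- The differential of the momentum of a vector field, in terms of the connection. -/
theorem mvfderiv_momentum (nabla : LinearConnection E M) {Z : ∀ x : M, TangentSpace 𝓘(ℝ, E) x}
    {u : CotangentBundle E M} (hZ : MDiffAt (T% Z) u.1)
    (v : TangentSpace 𝓘(ℝ, E) u.1) (q : E →L[ℝ] ℝ) :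
    mvfderiv (cotangentModel E) (momentum Z) u ((v, q) : E × (E →L[ℝ] ℝ)) =
      u.2 (nabla Z u.1 v) + (q (Z u.1 : E) - verticalPart nabla u v (Z u.1 : E)) := by
  let ξ : TangentSpace (cotangentModel E) u := ((v, q) : E × (E →L[ℝ] ℝ))
  let r : E →L[ℝ] ℝ := q - verticalPart nabla u v
  -- The difference of the two sides is tensorial in `Z`, since both have the same Leibniz term. It
  -- thus suffices to check coordinate fields, whose momenta are linear fibre coordinates.
  let Φ : (∀ x : M, TangentSpace 𝓘(ℝ, E) x) → ℝ := fun Z =>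
    mvfderiv (cotangentModel E) (momentum Z) u ξ - (u.2 (nabla Z u.1 v) + r (Z u.1 : E))
  have hΦ : TensorialAt 𝓘(ℝ, E) E Φ u.1 := by
    constructor
    · intro f σ hf hσ
      have h1 : momentum (f • σ) = (fun z : CotangentBundle E M => f z.1) * momentum σ := by
        funext z
        simp [momentum]
      have h2 : MDifferentiableAt (cotangentModel E) 𝓘(ℝ, ℝ)
          (fun z : CotangentBundle E M => f z.1) u :=
        MDifferentiableAt.comp (g := f) u hf
          ((contMDiff_proj (n := ∞) (IB := 𝓘(ℝ, E)) (CotangentSpace E : M → Type _)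
            u).mdifferentiableAt (by simp))
      have h3 : u.2 (nabla (f • σ) u.1 v) =
          f u.1 * u.2 (nabla σ u.1 v) + mvfderiv 𝓘(ℝ, E) f u.1 v * u.2 (σ u.1) := by
        rw [nabla.isCovariantDerivativeOnUniv.leibniz hσ hf]
        simp only [add_apply, smul_apply, ContinuousLinearMap.smulRight_apply, map_add, map_smul]
        rfl
      have h4 : r ((f • σ) u.1 : E) = f u.1 * r (σ u.1 : E) := r.map_smul _ _
      have h5 : mvfderiv (cotangentModel E) (fun z : CotangentBundle E M => f z.1) u ξ =
        mvfderiv 𝓘(ℝ, E) f u.1 v := mvfderiv_comp_proj hf ξ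
      simp only [Φ]
      rw [h1, mvfderiv_mul h2 (mdifferentiableAt_momentum hσ), h3, h4, add_apply, smul_apply,
        smul_apply, h5]
      simp only [momentum, smul_eq_mul]
      ring
    · intro σ σ' hσ hσ'
      have h1 : (momentum (σ + σ') : CotangentBundle E M → ℝ) = momentum σ + momentum σ' := by
        funext z
        simp [momentum]
      have h3 : u.2 (nabla (σ + σ') u.1 v) = u.2 (nabla σ u.1 v) + u.2 (nabla σ' u.1 v) := by
        rw [nabla.isCovariantDerivativeOnUniv.add hσ hσ', add_apply, map_add]
      have h4 : r ((σ + σ') u.1 : E) = r (σ u.1 : E) + r (σ' u.1 : E) := r.map_add _ _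
      simp only [Φ]
      rw [h1, mvfderiv_add (mdifferentiableAt_momentum hσ) (mdifferentiableAt_momentum hσ'), h3, h4,
        add_apply]
      ring
  have h1 := hΦ.pointwise hZ (coordVectorField_mdifferentiableAt (E := E) u.1 (Z u.1 : E))
    (coordVectorField_self (E := E) u.1 (Z u.1 : E)).symm
  have h2 : ∀ e : E, Φ (coordVectorField u.1 e) = 0 := by
    intro e
    let l : E × (E →L[ℝ] ℝ) →L[ℝ] ℝ :=
      (ContinuousLinearMap.apply ℝ ℝ e) ∘L (ContinuousLinearMap.snd ℝ E (E →L[ℝ] ℝ))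
    have h3 : (momentum (coordVectorField u.1 e) : CotangentBundle E M → ℝ) =
        fun z => l (extChartAt (cotangentModel E) u z) :=
      funext fun z => ((extChartAt_cotangentBundle u z).2 e).symm
    have h4 : mvfderiv (cotangentModel E) (momentum (coordVectorField u.1 e)) u ξ = q e := by
      rw [h3, mvfderiv_clm_comp_extChartAt l (mem_chart_source _ u), mfderiv_extChartAt_self]
      rfl
    have h5 : r (coordVectorField u.1 e u.1 : E) = q e - u.2 (nabla (coordVectorField u.1 e) u.1 v) :=
      congrArg r (coordVectorField_self u.1 e)
    simp only [Φ]
    rw [h4, h5]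
    ring
  exact sub_eq_zero.1 (h1.trans (h2 _))

end CotangentManifold
end

/-! ### Horizontal lifts and the bracket of the lifted bivector -/

noncomputable section

section HorizontalLift

open Set Filter Topology VectorField

set_option linter.unusedSectionVars false

variable {E : Type*} [NormedAddCommGroup E] [NormedSpace ℝ E] [FiniteDimensional ℝ E]
  {M : Type*} [TopologicalSpace M] [ChartedSpace E M] [IsManifold 𝓘(ℝ, E) ∞ M]
  {nabla : LinearConnection E M} {w : ContravariantTwoTensor 𝓘(ℝ, E) M}

/-- For a horizontal vector the fibre component is exactly the Christoffel term, so only the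
covariant derivative survives. -/
theorem mvfderiv_momentum_horizontalLift {Z : ∀ x : M, TangentSpace 𝓘(ℝ, E) x}
    {u : CotangentBundle E M} (hZ : MDiffAt (T% Z) u.1) (v : TangentSpace 𝓘(ℝ, E) u.1) :
    mvfderiv (cotangentModel E) (momentum Z) u (horizontalLift nabla u v) = u.2 (nabla Z u.1 v) := by
  refine (mvfderiv_momentum nabla hZ v (verticalPart nabla u v)).trans ?_
  rw [sub_self, add_zero]

theorem mvfderiv_comp_proj_horizontalLift {f : M → ℝ} {u : CotangentBundle E M}
    (hf : MDifferentiableAt 𝓘(ℝ, E) 𝓘(ℝ, ℝ) f u.1) (v : TangentSpace 𝓘(ℝ, E) u.1) :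
    mvfderiv (cotangentModel E) (fun z : CotangentBundle E M => f z.1) u
      (horizontalLift nabla u v) = mvfderiv 𝓘(ℝ, E) f u.1 v :=
  mvfderiv_comp_proj hf _

/-- The restriction of the differential of a function on `T*M` to the horizontal space. -/
def horizontalDifferential (nabla : LinearConnection E M) (F : CotangentBundle E M → ℝ)
    (u : CotangentBundle E M) : TangentSpace 𝓘(ℝ, E) u.1 →L[ℝ] ℝ :=
  (mvfderiv (cotangentModel E) F u).comp (horizontalLift nabla u)

theorem horizontalLiftTensor_bracket (F G : CotangentBundle E M → ℝ) (u : CotangentBundle E M) :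
    (horizontalLiftTensor nabla w).bracket F G u =
      w u.1 (horizontalDifferential nabla F u) (horizontalDifferential nabla G u) :=
  rfl

theorem horizontalDifferential_comp_proj {f : M → ℝ} {u : CotangentBundle E M}
    (hf : MDifferentiableAt 𝓘(ℝ, E) 𝓘(ℝ, ℝ) f u.1) :
    horizontalDifferential nabla (fun z => f z.1) u = mvfderiv 𝓘(ℝ, E) f u.1 :=
  ContinuousLinearMap.ext fun v => mvfderiv_comp_proj_horizontalLift hf v

theorem horizontalLiftTensor_bracket_comp_proj_left {f : M → ℝ} {u : CotangentBundle E M}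
    (hf : MDifferentiableAt 𝓘(ℝ, E) 𝓘(ℝ, ℝ) f u.1) (G : CotangentBundle E M → ℝ) :
    (horizontalLiftTensor nabla w).bracket (fun z => f z.1) G u =
      mvfderiv (cotangentModel E) G u (horizontalLift nabla u (w.hamiltonian f u.1)) := by
  rw [horizontalLiftTensor_bracket, horizontalDifferential_comp_proj hf]
  exact (w.isHamiltonian_hamiltonian f u.1 (horizontalDifferential nabla G u)).symm

theorem horizontalLiftTensor_bracket_comp_proj {f g : M → ℝ}
    (hf : ContMDiff 𝓘(ℝ, E) 𝓘(ℝ, ℝ) ∞ f) (hg : ContMDiff 𝓘(ℝ, E) 𝓘(ℝ, ℝ) ∞ g) :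
    (horizontalLiftTensor nabla w).bracket (fun z => f z.1) (fun z => g z.1) =
      fun z => w.bracket f g z.1 := by
  funext u
  rw [horizontalLiftTensor_bracket_comp_proj_left ((hf _).mdifferentiableAt (by simp)),
    mvfderiv_comp_proj_horizontalLift ((hg _).mdifferentiableAt (by simp))]
  exact w.isHamiltonian_hamiltonian f u.1 _

theorem horizontalLiftTensor_bracket_comp_proj_momentum {f : M → ℝ}
    (hf : ContMDiff 𝓘(ℝ, E) 𝓘(ℝ, ℝ) ∞ f) {Z : ∀ x : M, TangentSpace 𝓘(ℝ, E) x}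
    (hZ : IsSmoothVectorField Z) :
    (horizontalLiftTensor nabla w).bracket (fun z => f z.1) (momentum Z) =
      momentum (nabla.deriv (w.hamiltonian f) Z) := by
  funext u
  rw [horizontalLiftTensor_bracket_comp_proj_left ((hf _).mdifferentiableAt (by simp)),
    mvfderiv_momentum_horizontalLift (hZ.mdifferentiableAt _)]
  rfl

/-- The horizontal lift of a smooth vector field is smooth. -/
theorem contMDiff_horizontalLift [T2Space M] (hnabla : nabla.ContMDiffCovariantDerivative ∞)
    {V : ∀ x : M, TangentSpace 𝓘(ℝ, E) x} (hV : IsSmoothVectorField V) :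
    ContMDiff (cotangentModel E) (cotangentModel E).tangent ∞
      (T% (fun u : CotangentBundle E M => horizontalLift nabla u (V u.1))) := by
  intro u
  refine contMDiffAt_vectorField_of_coordinates fun l => ?_
  have hu := (FiberBundle.continuous_proj (E →L[ℝ] ℝ) (CotangentSpace E : M → Type _)).tendsto u
  -- a linear form on the model space is the sum of a base and a fibre coordinate
  obtain ⟨e, he⟩ := exists_apply_eq_of_bidual
    (l ∘L ContinuousLinearMap.inr ℝ E (E →L[ℝ] ℝ)).toLinearMap
  let a : E →L[ℝ] ℝ := l ∘L ContinuousLinearMap.inl ℝ E (E →L[ℝ] ℝ)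
  obtain ⟨f, hf, hfa⟩ := exists_contMDiff_eventuallyEq_extChartAt (I := 𝓘(ℝ, E)) u.1 a
  obtain ⟨Z, hZ, hZe⟩ := exists_contMDiff_eventuallyEq_coordVectorField (E := E) u.1 e
  have hfs := contMDiff_comp_proj hf
  have hZs := contMDiff_momentum hZ
  refine ⟨(fun z => f z.1) + momentum Z, ?_, ?_⟩
  · filter_upwards [hu.eventually hfa, hu.eventually hZe] with z hz1 hz2
    obtain ⟨h1, h2⟩ := extChartAt_cotangentBundle u z
    have h3 : l (extChartAt (cotangentModel E) u z) =
        a (extChartAt (cotangentModel E) u z).1 + (extChartAt (cotangentModel E) u z).2 e := by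
      rw [he]
      change _ = l (_, 0) + l (0, _)
      rw [← map_add]
      simp
    rw [h3, h1, h2, Pi.add_apply, hz1]
    simp only [momentum, hz2]
  · have h4 : (fun z => mvfderiv (cotangentModel E) ((fun z => f z.1) + momentum Z) z
        (horizontalLift nabla z (V z.1))) =
        (fun z => mvfderiv 𝓘(ℝ, E) f z.1 (V z.1)) + momentum (nabla.deriv V Z) := by
      funext z
      rw [mvfderiv_add ((hfs z).mdifferentiableAt (by simp)) ((hZs z).mdifferentiableAt (by simp)),
        add_apply, mvfderiv_momentum_horizontalLift (hZ.mdifferentiableAt _),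
        mvfderiv_comp_proj_horizontalLift ((hf _).mdifferentiableAt (by simp))]
      rfl
    rw [h4]
    have h5 : ContMDiff 𝓘(ℝ, E) 𝓘(ℝ, ℝ) ∞ (fun x => mvfderiv 𝓘(ℝ, E) f x (V x)) :=
      fun x => hf.contMDiffAt_mvfderiv_apply (hV x)
    exact (contMDiff_comp_proj h5).add
      (contMDiff_momentum (nabla.isSmoothVectorField_deriv hnabla hV hZ)) u

/-- Expanding the horizontal part of `dF` in a local coframe `dy_i` of the base writes the bracket
as a sum of products of derivatives along smooth horizontal fields. Smoothness of the bracket and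
its behaviour at horizontally critical points both follow. -/
theorem exists_local_horizontalLiftTensor_bracket [T2Space M] (x₀ : M) :
    ∃ (n : ℕ) (y : Fin n → M → ℝ) (Z : Fin n → ∀ x : M, TangentSpace 𝓘(ℝ, E) x),
      (∀ i, ContMDiff 𝓘(ℝ, E) 𝓘(ℝ, ℝ) ∞ (y i)) ∧ (∀ i, IsSmoothVectorField (Z i)) ∧
      ∀ (F G : CotangentBundle E M → ℝ) (u : CotangentBundle E M), u.1 = x₀ → ∀ᶠ z in 𝓝 u,
        (horizontalLiftTensor nabla w).bracket F G z = ∑ i,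
          mvfderiv (cotangentModel E) F z (horizontalLift nabla z (Z i z.1)) *
          mvfderiv (cotangentModel E) G z (horizontalLift nabla z (w.hamiltonian (y i) z.1)) := by
  obtain ⟨n, y, Z, hy, hZ, h⟩ := exists_local_coframe (E := E) x₀
  refine ⟨n, y, Z, hy, hZ, fun F G u hu => ?_⟩
  have hu' := (FiberBundle.continuous_proj (E →L[ℝ] ℝ) (CotangentSpace E : M → Type _)).tendsto u
  change Tendsto _ _ (𝓝 u.1) at hu'
  rw [hu] at hu'
  filter_upwards [hu'.eventually h] with z hz
  have h1 : horizontalDifferential nabla F z = ∑ i,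
      horizontalDifferential nabla F z (Z i z.1) • mvfderiv 𝓘(ℝ, E) (y i) z.1 := by
    refine ContinuousLinearMap.ext fun v => ?_
    conv_lhs => rw [hz v]
    simp [map_sum, mul_comm]
  rw [horizontalLiftTensor_bracket, h1, map_sum, LinearMap.sum_apply]
  refine Finset.sum_congr rfl fun i _ => ?_
  rw [map_smul, LinearMap.smul_apply, smul_eq_mul]
  exact congrArg _ (w.isHamiltonian_hamiltonian (y i) z.1 (horizontalDifferential nabla G z)).symm

theorem isBivectorField_horizontalLiftTensor [T2Space M] (hw : w.IsBivectorField)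
    (hnabla : nabla.ContMDiffCovariantDerivative ∞) :
    (horizontalLiftTensor nabla w).IsBivectorField := by
  refine ⟨fun u a => hw.alternating u.1 _, fun F G hF hG u => ?_⟩
  obtain ⟨n, y, Z, hy, hZ, h⟩ := exists_local_horizontalLiftTensor_bracket (nabla := nabla)
    (w := w) u.1
  refine ContMDiffAt.congr_of_eventuallyEq ?_ (h F G u rfl)
  exact contMDiffAt_finsetSum fun i _ =>
    (hF.contMDiffAt_mvfderiv_apply (contMDiff_horizontalLift hnabla (hZ i) u)).mul
    (hG.contMDiffAt_mvfderiv_apply (contMDiff_horizontalLift hnabla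
      (hw.isSmoothVectorField_hamiltonian (hy i)) u))

/-- In the local formula both factors of every product vanish at `u`, so the product rule kills the
differential. -/
theorem mvfderiv_horizontalLiftTensor_bracket_eq_zero [T2Space M] (hw : w.IsBivectorField)
    (hnabla : nabla.ContMDiffCovariantDerivative ∞) {F G : CotangentBundle E M → ℝ}
    (hF : ContMDiff (cotangentModel E) 𝓘(ℝ, ℝ) ∞ F) (hG : ContMDiff (cotangentModel E) 𝓘(ℝ, ℝ) ∞ G)
    {u : CotangentBundle E M} (hFu : horizontalDifferential nabla F u = 0)
    (hGu : horizontalDifferential nabla G u = 0) :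
    mvfderiv (cotangentModel E) ((horizontalLiftTensor nabla w).bracket F G) u = 0 := by
  obtain ⟨n, y, Z, hy, hZ, h⟩ := exists_local_horizontalLiftTensor_bracket (nabla := nabla)
    (w := w) u.1
  have h1 := h F G u rfl
  rw [Filter.EventuallyEq.mvfderiv_eq h1]
  set A : Fin n → CotangentBundle E M → ℝ := fun i z =>
    mvfderiv (cotangentModel E) F z (horizontalLift nabla z (Z i z.1))
  set B : Fin n → CotangentBundle E M → ℝ := fun i z =>
    mvfderiv (cotangentModel E) G z (horizontalLift nabla z (w.hamiltonian (y i) z.1))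
  have hA : ∀ i, MDifferentiableAt (cotangentModel E) 𝓘(ℝ, ℝ) (A i) u := fun i =>
    (hF.contMDiffAt_mvfderiv_apply (contMDiff_horizontalLift hnabla (hZ i) u)).mdifferentiableAt
      (by simp)
  have hB : ∀ i, MDifferentiableAt (cotangentModel E) 𝓘(ℝ, ℝ) (B i) u := fun i =>
    (hG.contMDiffAt_mvfderiv_apply (contMDiff_horizontalLift hnabla
      (hw.isSmoothVectorField_hamiltonian (hy i)) u)).mdifferentiableAt (by simp)
  have hA0 : ∀ i, A i u = 0 := fun i => DFunLike.congr_fun hFu _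
  have hB0 : ∀ i, B i u = 0 := fun i => DFunLike.congr_fun hGu _
  have key : ∀ s : Finset (Fin n), MDifferentiableAt (cotangentModel E) 𝓘(ℝ, ℝ)
      (∑ i ∈ s, A i * B i) u ∧ mvfderiv (cotangentModel E) (∑ i ∈ s, A i * B i) u = 0 := by
    intro s
    induction s using Finset.induction_on with
    | empty => exact ⟨mdifferentiableAt_const, by rw [Finset.sum_empty, mvfderiv_zero]⟩
    | insert i s hi ih =>
      rw [Finset.sum_insert hi]
      refine ⟨((hA i).mul (hB i)).add ih.1, ?_⟩
      rw [mvfderiv_add ((hA i).mul (hB i)) ih.1, ih.2, mvfderiv_mul (hA i) (hB i), hA0, hB0]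
      simp
  convert (key Finset.univ).2 using 2
  funext z
  simp [A, B]

end HorizontalLift
end

/-! ### The Jacobi identity for the lift -/

noncomputable section

section PoissonLift

open Set Filter Topology VectorField

set_option linter.unusedSectionVars false

variable {E : Type*} [NormedAddCommGroup E] [NormedSpace ℝ E] [FiniteDimensional ℝ E]
  {M : Type*} [TopologicalSpace M] [T2Space M] [ChartedSpace E M] [IsManifold 𝓘(ℝ, E) ∞ M]
  {nabla : LinearConnection E M} {w : ContravariantTwoTensor 𝓘(ℝ, E) M}

theorem jacobiator_comp_proj (hw : w.IsPoisson) {f g h : M → ℝ}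
    (hf : ContMDiff 𝓘(ℝ, E) 𝓘(ℝ, ℝ) ∞ f) (hg : ContMDiff 𝓘(ℝ, E) 𝓘(ℝ, ℝ) ∞ g)
    (hh : ContMDiff 𝓘(ℝ, E) 𝓘(ℝ, ℝ) ∞ h) :
    (horizontalLiftTensor nabla w).jacobiator (fun z => f z.1) (fun z => g z.1)
      (fun z => h z.1) = 0 := by
  rw [ContravariantTwoTensor.jacobiator, horizontalLiftTensor_bracket_comp_proj hf hg,
    horizontalLiftTensor_bracket_comp_proj hg hh, horizontalLiftTensor_bracket_comp_proj hh hf,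
    horizontalLiftTensor_bracket_comp_proj (hw.smooth f g hf hg) hh,
    horizontalLiftTensor_bracket_comp_proj (hw.smooth g h hg hh) hf,
    horizontalLiftTensor_bracket_comp_proj (hw.smooth h f hh hf) hg]
  funext z
  exact congrFun (hw.jacobi f g h hf hg hh) z.1

/-- The Jacobiator of `w^H` on two base functions and a momentum is given by the curvature. -/
theorem jacobiator_comp_proj_momentum (hw : w.IsPoisson)
    (hnabla : nabla.ContMDiffCovariantDerivative ∞) {f g : M → ℝ}
    (hf : ContMDiff 𝓘(ℝ, E) 𝓘(ℝ, ℝ) ∞ f) (hg : ContMDiff 𝓘(ℝ, E) 𝓘(ℝ, ℝ) ∞ g)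
    {Z : ∀ x : M, TangentSpace 𝓘(ℝ, E) x} (hZ : IsSmoothVectorField Z) :
    (horizontalLiftTensor nabla w).jacobiator (fun z => f z.1) (fun z => g z.1) (momentum Z) =
      -momentum (nabla.curvature (w.hamiltonian f) (w.hamiltonian g) Z) := by
  have hw' := hw.toIsBivectorField
  have hW := isBivectorField_horizontalLiftTensor hw' hnabla
  have hZf := nabla.isSmoothVectorField_deriv hnabla (hw'.isSmoothVectorField_hamiltonian hf) hZ
  have hZg := nabla.isSmoothVectorField_deriv hnabla (hw'.isSmoothVectorField_hamiltonian hg) hZ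
  rw [ContravariantTwoTensor.jacobiator, horizontalLiftTensor_bracket_comp_proj hf hg,
    horizontalLiftTensor_bracket_comp_proj_momentum hg hZ,
    hW.bracket_swap (momentum Z), horizontalLiftTensor_bracket_comp_proj_momentum hf hZ,
    ContravariantTwoTensor.bracket_neg_left, hW.bracket_swap _ (fun z => f z.1),
    hW.bracket_swap _ (fun z => g z.1),
    horizontalLiftTensor_bracket_comp_proj_momentum hf hZg,
    horizontalLiftTensor_bracket_comp_proj_momentum hg hZf,
    horizontalLiftTensor_bracket_comp_proj_momentum (hw.smooth f g hf hg) hZ,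
    LinearConnection.curvature, hw.isHamiltonian_mlieBracket hf hg (w.isHamiltonian_hamiltonian f)
      (w.isHamiltonian_hamiltonian g) (w.isHamiltonian_hamiltonian _)]
  funext u
  simp only [Pi.add_apply, Pi.neg_apply, momentum, Pi.sub_apply, map_sub]
  ring

/-- In `{{F, G}, K}` the inner bracket is critical at `u`; each of the other two terms has `F` or
`G` as an outer argument. `K` is arbitrary, so a third momentum is allowed. -/
theorem jacobiator_eq_zero_of_horizontalDifferential_eq_zero (hw : w.IsBivectorField)
    (hnabla : nabla.ContMDiffCovariantDerivative ∞) {F G : CotangentBundle E M → ℝ}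
    (hF : ContMDiff (cotangentModel E) 𝓘(ℝ, ℝ) ∞ F) (hG : ContMDiff (cotangentModel E) 𝓘(ℝ, ℝ) ∞ G)
    {u : CotangentBundle E M} (hFu : horizontalDifferential nabla F u = 0)
    (hGu : horizontalDifferential nabla G u = 0) (K : CotangentBundle E M → ℝ) :
    (horizontalLiftTensor nabla w).jacobiator K F G u = 0 := by
  simp only [ContravariantTwoTensor.jacobiator, Pi.add_apply]
  have h1 : (horizontalLiftTensor nabla w).bracket
      ((horizontalLiftTensor nabla w).bracket F G) K u = 0 := by
    rw [ContravariantTwoTensor.bracket,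
      mvfderiv_horizontalLiftTensor_bracket_eq_zero hw hnabla hF hG hFu hGu]
    simp
  rw [h1, horizontalLiftTensor_bracket, horizontalLiftTensor_bracket, hFu, hGu]
  simp

/-- There is a vector field with prescribed value and vanishing covariant derivative at a point. -/
theorem exists_isSmoothVectorField_parallel_at (hnabla : nabla.ContMDiffCovariantDerivative ∞)
    (x : M) (e : TangentSpace 𝓘(ℝ, E) x) :
    ∃ Y : ∀ x : M, TangentSpace 𝓘(ℝ, E) x, IsSmoothVectorField Y ∧ Y x = e ∧ nabla Y x = 0 := by
  obtain ⟨Y₀, hY₀, hY₀e⟩ := exists_contMDiff_eventuallyEq_coordVectorField (E := E) x (e : E)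
  have hY₀x : Y₀ x = e := hY₀e.self_of_nhds.trans (coordVectorField_self (E := E) x e)
  obtain ⟨n, y, Z, hy, hZ, h⟩ := exists_local_coframe (E := E) x
  have hD : ∀ i, IsSmoothVectorField (nabla.deriv (Z i) Y₀) := fun i =>
    nabla.isSmoothVectorField_deriv hnabla (hZ i) hY₀
  -- The field is `Y₀ - ∑ (y_i - y_i(x)) ∇_{Z_i} Y₀`: the correction vanishes at `x`, and its
  -- covariant derivative there is `∑ dy_i ⊗ ∇_{Z_i} Y₀ = ∇Y₀`.
  let c : Fin n → M → ℝ := fun i p => y i p - y i x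
  have hc : ∀ i, ContMDiff 𝓘(ℝ, E) 𝓘(ℝ, ℝ) ∞ (c i) := fun i => (hy i).sub contMDiff_const
  have hcx : ∀ i, c i x = 0 := fun i => sub_self _
  have hdc : ∀ i, mvfderiv 𝓘(ℝ, E) (c i) x = mvfderiv 𝓘(ℝ, E) (y i) x := fun i => by
    have := mvfderiv_sub ((hy i x).mdifferentiableAt (by simp))
      (mdifferentiableAt_const (I := 𝓘(ℝ, E)) (I' := 𝓘(ℝ, ℝ)) (c := y i x) (x := x))
    rw [mvfderiv_const, sub_zero] at this
    exact this
  have key : ∀ s : Finset (Fin n), IsSmoothVectorField (∑ i ∈ s, c i • nabla.deriv (Z i) Y₀) ∧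
      nabla (∑ i ∈ s, c i • nabla.deriv (Z i) Y₀) x =
        ∑ i ∈ s, (mvfderiv 𝓘(ℝ, E) (y i) x).smulRight (nabla Y₀ x (Z i x)) := by
    intro s
    induction s using Finset.induction_on with
    | empty =>
      refine ⟨contMDiff_zeroSection ℝ (TangentSpace 𝓘(ℝ, E) : M → Type _), ?_⟩
      rw [Finset.sum_empty, Finset.sum_empty]
      exact nabla.isCovariantDerivativeOnUniv.zero
    | insert i s hi ih =>
      have h1 : IsSmoothVectorField (c i • nabla.deriv (Z i) Y₀) := (hc i).smul_section (hD i)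
      rw [Finset.sum_insert hi, Finset.sum_insert hi]
      refine ⟨ContMDiff.add_section h1 ih.1, ?_⟩
      rw [nabla.isCovariantDerivativeOnUniv.add (h1.mdifferentiableAt x) (ih.1.mdifferentiableAt x),
        ih.2, nabla.isCovariantDerivativeOnUniv.leibniz ((hD i).mdifferentiableAt x)
          ((hc i x).mdifferentiableAt (by simp)), hcx, zero_smul, zero_add, hdc]
      rfl
  obtain ⟨hS, hSx⟩ := key Finset.univ
  set S := ∑ i, c i • nabla.deriv (Z i) Y₀ with hSdef
  have hS' : IsSmoothVectorField (-S) := ContMDiff.neg_section hS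
  have hnS : nabla (-S) x = -nabla S x := by
    have h2 := nabla.isCovariantDerivativeOnUniv.smul_const (-1) (hS.mdifferentiableAt x)
    rwa [neg_one_smul, neg_one_smul] at h2
  refine ⟨Y₀ + -S, ContMDiff.add_section hY₀ hS', ?_, ?_⟩
  · have : S x = 0 := by simp [hSdef, hcx]
    simp [hY₀x, this]
  · rw [nabla.isCovariantDerivativeOnUniv.add (hY₀.mdifferentiableAt x) (hS'.mdifferentiableAt x),
      hnS, hSx]
    refine ContinuousLinearMap.ext fun v => ?_
    have hv := congrArg (nabla Y₀ x) (h.self_of_nhds v)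
    rw [map_sum] at hv
    rw [add_apply, hv, neg_apply, sum_apply]
    simp

/-- Every covector of `T*M` is the sum of the differentials of a base function and of the momentum
of a vector field that is parallel at the base point. -/
theorem exists_mvfderiv_eq_comp_proj_add_momentum (hnabla : nabla.ContMDiffCovariantDerivative ∞)
    {F : CotangentBundle E M → ℝ} (u : CotangentBundle E M) :
    ∃ (f : M → ℝ) (Y : ∀ x : M, TangentSpace 𝓘(ℝ, E) x), ContMDiff 𝓘(ℝ, E) 𝓘(ℝ, ℝ) ∞ f ∧
      IsSmoothVectorField Y ∧ horizontalDifferential nabla (momentum Y) u = 0 ∧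
      mvfderiv (cotangentModel E) F u =
        mvfderiv (cotangentModel E) ((fun z => f z.1) + momentum Y) u := by
  let l : E × (E →L[ℝ] ℝ) →L[ℝ] ℝ := mvfderiv (cotangentModel E) F u
  -- The vector `e` represents `dF` on vertical vectors and is the value prescribed for `Y`; the
  -- horizontal part of `dF` is left to `f`.
  obtain ⟨e, he⟩ := exists_apply_eq_of_bidual
    (l ∘L ContinuousLinearMap.inr ℝ E (E →L[ℝ] ℝ)).toLinearMap
  obtain ⟨Y, hY, hYe, hYx⟩ := exists_isSmoothVectorField_parallel_at hnabla u.1 e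
  obtain ⟨f, hf, hfa⟩ := exists_mvfderiv_eq (I := 𝓘(ℝ, E)) u.1 (horizontalDifferential nabla F u)
  refine ⟨f, Y, hf, hY, ?_, ?_⟩
  · refine ContinuousLinearMap.ext fun v => ?_
    refine (mvfderiv_momentum_horizontalLift (hY.mdifferentiableAt u.1) v).trans ?_
    rw [hYx]
    simp
  · rw [mvfderiv_add ((contMDiff_comp_proj hf u).mdifferentiableAt (by simp))
      ((contMDiff_momentum hY u).mdifferentiableAt (by simp))]
    refine ContinuousLinearMap.ext fun ξ => ?_
    obtain ⟨v, q⟩ : E × (E →L[ℝ] ℝ) := ξ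
    have h1 := mvfderiv_momentum nabla (hY.mdifferentiableAt u.1) v q
    have h2 := mvfderiv_comp_proj (u := u) ((hf _).mdifferentiableAt (by simp))
      ((v, q) : E × (E →L[ℝ] ℝ))
    rw [hfa] at h2
    rw [hYx, hYe] at h1
    -- This splits `(v, q)` into the horizontal lift of `v` and a vertical remainder.
    have h3 : l (v, verticalPart nabla u v) + l (0, q - verticalPart nabla u v) = l (v, q) := by
      rw [← map_add]
      simp
    have h4 : l (0, q - verticalPart nabla u v) = q e - verticalPart nabla u v e :=
      (he (q - verticalPart nabla u v)).symm
    refine h3.symm.trans ?_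
    rw [h4]
    have h5 : u.2 ((0 : E →L[ℝ] E) v) + (q e - verticalPart nabla u v e) =
        q e - verticalPart nabla u v e :=
      (congrArg (· + _) (map_zero (u.2 : E →L[ℝ] ℝ))).trans (zero_add _)
    exact (congrArg₂ (fun a b : ℝ => a + b) h2 (h1.trans h5)).symm

theorem isPoisson_horizontalLiftTensor_iff (hw : w.IsPoisson)
    (hnabla : nabla.ContMDiffCovariantDerivative ∞) :
    (horizontalLiftTensor nabla w).IsPoisson ↔
      ∀ (f g : M → ℝ) (Z : ∀ x : M, TangentSpace 𝓘(ℝ, E) x),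
        ContMDiff 𝓘(ℝ, E) 𝓘(ℝ, ℝ) ∞ f → ContMDiff 𝓘(ℝ, E) 𝓘(ℝ, ℝ) ∞ g →
          IsSmoothVectorField Z → nabla.curvature (w.hamiltonian f) (w.hamiltonian g) Z = 0 := by
  have hw' := hw.toIsBivectorField
  have hW := isBivectorField_horizontalLiftTensor hw' hnabla
  constructor
  · intro hP f g Z hf hg hZ
    have h1 := hP.jacobi _ _ _ (contMDiff_comp_proj hf) (contMDiff_comp_proj hg)
      (contMDiff_momentum hZ)
    have h2 := (jacobiator_comp_proj_momentum hw hnabla hf hg hZ).symm.trans h1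
    funext x
    -- The momentum of the curvature field vanishes on the whole fibre over `x`, and covectors
    -- separate tangent vectors.
    have h3 : ∀ a : E →L[ℝ] ℝ,
        a (nabla.curvature (w.hamiltonian f) (w.hamiltonian g) Z x : E) = a 0 := fun a => by
      have h4 : -a (nabla.curvature (w.hamiltonian f) (w.hamiltonian g) Z x : E) = 0 :=
        congrFun h2 (⟨x, a⟩ : CotangentBundle E M)
      rw [map_zero]
      linarith
    exact (SeparatingDual.eq_iff_forall_dual_eq (R := ℝ) (V := E)).2 h3
  · intro hR
    refine ⟨hW, fun F₁ F₂ F₃ hF₁ hF₂ hF₃ => ?_⟩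
    funext u
    obtain ⟨f₁, Y₁, hf₁, hY₁, hY₁u, h₁⟩ := exists_mvfderiv_eq_comp_proj_add_momentum hnabla
      (F := F₁) u
    obtain ⟨f₂, Y₂, hf₂, hY₂, hY₂u, h₂⟩ := exists_mvfderiv_eq_comp_proj_add_momentum hnabla
      (F := F₂) u
    obtain ⟨f₃, Y₃, hf₃, hY₃, hY₃u, h₃⟩ := exists_mvfderiv_eq_comp_proj_add_momentum hnabla
      (F := F₃) u
    have hp₁ := contMDiff_comp_proj hf₁
    have hp₂ := contMDiff_comp_proj hf₂
    have hp₃ := contMDiff_comp_proj hf₃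
    have hm₁ := contMDiff_momentum hY₁
    have hm₂ := contMDiff_momentum hY₂
    have hm₃ := contMDiff_momentum hY₃
    have hppm : ∀ {f g : M → ℝ} {Y : ∀ x : M, TangentSpace 𝓘(ℝ, E) x},
        ContMDiff 𝓘(ℝ, E) 𝓘(ℝ, ℝ) ∞ f → ContMDiff 𝓘(ℝ, E) 𝓘(ℝ, ℝ) ∞ g → IsSmoothVectorField Y →
        (horizontalLiftTensor nabla w).jacobiator (fun z => f z.1) (fun z => g z.1)
          (momentum Y) u = 0 := by
      intro f g Y hf hg hY
      rw [jacobiator_comp_proj_momentum hw hnabla hf hg hY, hR f g Y hf hg hY]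
      simp [momentum]
    have hmm : ∀ {Y Y' : ∀ x : M, TangentSpace 𝓘(ℝ, E) x}, IsSmoothVectorField Y →
        IsSmoothVectorField Y' → horizontalDifferential nabla (momentum Y) u = 0 →
        horizontalDifferential nabla (momentum Y') u = 0 → ∀ K,
        (horizontalLiftTensor nabla w).jacobiator K (momentum Y) (momentum Y') u = 0 :=
      fun hY hY' hu hu' K => jacobiator_eq_zero_of_horizontalDifferential_eq_zero hw' hnabla
        (contMDiff_momentum hY) (contMDiff_momentum hY') hu hu' K
    change (horizontalLiftTensor nabla w).jacobiator F₁ F₂ F₃ u = 0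
    rw [hW.jacobiator_congr hF₁ (hp₁.add hm₁) hF₂ (hp₂.add hm₂) hF₃ (hp₃.add hm₃) h₁ h₂ h₃,
      hW.jacobiator_add_add_add hp₁ hm₁ hp₂ hm₂ hp₃ hm₃]
    simp only [Pi.add_apply]
    rw [jacobiator_comp_proj hw hf₁ hf₂ hf₃, hppm hf₁ hf₂ hY₃, hppm hf₂ hf₃ hY₁, hppm hf₃ hf₁ hY₂,
      hmm hY₂ hY₃ hY₂u hY₃u, hmm hY₃ hY₁ hY₃u hY₁u, hmm hY₁ hY₂ hY₁u hY₂u, hmm hY₂ hY₃ hY₂u hY₃u]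
    simp

end PoissonLift
end

theorem corollary3p5 {E : Type*} [NormedAddCommGroup E] [NormedSpace ℝ E] [FiniteDimensional ℝ E]
    {M : Type*} [TopologicalSpace M] [T2Space M] [ChartedSpace E M] [IsManifold 𝓘(ℝ, E) ∞ M]
    (w : ContravariantTwoTensor 𝓘(ℝ, E) M) (hw : w.IsPoisson)
    (nabla : LinearConnection E M) (hnabla : nabla.ContMDiffCovariantDerivative ∞) :
    ((horizontalLiftTensor nabla w).IsPoisson ↔
      ∀ (α β : ∀ x : M, CotangentSpace E x) (Z : ∀ x : M, TangentSpace 𝓘(ℝ, E) x),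
        IsSmoothOneForm α → IsSmoothOneForm β → IsSmoothVectorField Z →
          contravariantCurvature w (nabla.contravariant w) α β Z = 0) ∧
    ((horizontalLiftTensor nabla w).IsPoisson ↔
      ∀ (f g : M → ℝ) (Z : ∀ x : M, TangentSpace 𝓘(ℝ, E) x),
        ContMDiff 𝓘(ℝ, E) 𝓘(ℝ, ℝ) ∞ f → ContMDiff 𝓘(ℝ, E) 𝓘(ℝ, ℝ) ∞ g →
          IsSmoothVectorField Z →
            nabla.curvature (w.hamiltonian f) (w.hamiltonian g) Z = 0) := by
  have h := isPoisson_horizontalLiftTensor_iff hw hnabla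
  refine ⟨h.trans ⟨fun hR α β Z hα hβ hZ => ?_, fun hC f g Z hf hg hZ => ?_⟩, h⟩
  · exact (contravariantCurvature_eq_zero_iff hw hnabla hZ).2
      (fun f g hf hg => hR f g Z hf hg hZ) α β hα hβ
  · exact (contravariantCurvature_eq_zero_iff hw hnabla hZ).1
      (fun α β hα hβ => hC α β Z hα hβ hZ) f g hf hg
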